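/- Setting. Let $F:\mathbb R^d\times\Xi\to\mathbb R$, let $P$ be a probability measure on $\Xi$, and let $f(x)=\int F(x,\xi)\,dP(\xi)$ (all $F(x,\cdot)$ integrable). Fix $x_0\in\mathbb R^d$, $\Delta_0,\Delta_{\max},\theta,\kappa,\mu>0$, $\eta,\gamma_2\in(0,1)$, $\gamma_1>1$ and $\lambda_k>0$. The refined ASTRO-DF algorithm starts at $X_0=x_0$ with radius $\Delta_0$. In iteration $k$ it samples the oracle at the design points $X_k$, $X_k\pm\Delta_k e_i$ ($1\le i\le d$), builds a model, and samples it at a candidate $\widetilde X_{k+1}=X_k+S_k$. At each sampled point $x$ the estimate $\bar F(x)$ is the average of the first $N(x)$ outputs $F(x,\xi_j)$, where $$N(x)=\min\Big\{n\ge\max(2,\lambda_k):\ \hat\sigma(x,n)/\sqrt n\le\kappa\Delta_k^2/\sqrt{\lambda_k}\Big\}$$ and $\hat\sigma^2(x,n)$ is the unbiased sample variance of the first $n$ outputs. The model $M_k(X_k+s)=\beta_0+s^{\mathsf T}G_k+\frac12 s^{\mathsf T}\mathsf H_k s$ with $\mathsf H_k$ diagonal interpolates $\bar F$ at the $2d+1$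 design points; $S_k$ is an approximate minimizer of $M_k(X_k+s)$ over $\|s\|\le\Delta_k$; and $\hat X_{k+1}$ is a design point with least estimate. Put $\hat R_k=\bar F(X_k)-\bar F(\hat X_{k+1})$, $\widetilde R_k=\bar F(X_k)-\bar F(\widetilde X_{k+1})$, $R_k=M_k(X_k)-M_k(\widetilde X_{k+1})$. If $\hat R_k>\max\{\widetilde R_k,\theta\Delta_k^2\}$, then $X_{k+1}=\hat X_{k+1}$ and $\Delta_{k+1}=\min(\gamma_1\Delta_k,\Delta_{\max})$; otherwise, if $\widetilde R_k\ge\eta R_k$ and $\mu\|G_k\|\ge\Delta_k$, then $X_{k+1}=\widetilde X_{k+1}$ and $\Delta_{k+1}=\min(\gamma_1\Delta_k,\Delta_{\max})$; otherwise $X_{k+1}=X_k$ and $\Delta_{k+1}=\gamma_2\Delta_k$. In the first two cases iteration $k$ is called successful. For $\epsilon>0$ let $T_\epsilon=\min\{k\ge 0:\|\nabla f(X_k)\|\le\epsilon\}$ ($=\infty$ if there is no such $k$). Assumptions. (1) $f$ is $C^2$ with Lipschitz gradient and Lipschitz Hessian on an open set that almost surely contains all trust regions $\{x:\|x-X_k\|\le\Delta_k\}$.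 (2) There is a filtration $(\mathcal F_k)$, $\mathcal F_k$ being the information available before the sampling of iteration $k$, such that $X_k,\Delta_k$ are $\mathcal F_k$-measurable. For each $k$ and each of the $2d+2$ sampled points (labelled by $i$), every oracle input has law $P$, and the errors $E^i_{k,j}$ (output $j$ minus the value of $f$ at the point), $j\ge1$, are $\mathcal F_{k+1}$-measurable, have mean zero, are iid with a law that does not depend on $k$, and as a sequence are independent of $\mathcal F_k$. There are $\sigma,b>0$ with $\mathbb E|E^i_{k,j}|^m\le\frac{m!}{2}b^{m-2}\sigma^2$ for all $m\ge2$ and all $k,i,j$. Errors at different points of the same iteration may depend on each other arbitrarily. (3) There are $\kappa_{fcd}\in(0,1]$ and $\kappa_{\mathsf H}\in(0,\infty)$ such that almost surely, for all $k$, $\|\mathsf H_k\|\le\kappa_{\mathsf H}$ and $M_k(X_k)-M_k(X_k+S_k)\ge\kappa_{fcd}\,[M_k(X_k)-M_k(X_k+S^c_k)]$ for some Cauchy step $S^c_k$, i.e. $\|S^c_k\|\le\Delta_k$ and $M_k(X_k)-M_k(X_k+S_k^c)\ge\frac12\|G_k\|\min(\|G_k\|/\|\mathsf H_k\|,\Delta_k)$,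 where $\|G_k\|/\|\mathsf H_k\|=+\infty$ if $\mathsf H_k=0$. (4) $(\log k)^{1+\epsilon_\lambda}=\mathcal O(\lambda_k)$ for some $\epsilon_\lambda\in(0,1)$. Claim. There is a deterministic constant $c_{lb}\in(0,\infty)$ such that, almost surely, there is a (random) $K_E\in\mathbb N$ for which, for every $\epsilon>0$, every iteration $k$ with $K_E\le k<T_\epsilon$ and $\Delta_k<c_{lb}\,\epsilon$ is successful. Consequently, almost surely there is a (random) $c>0$ such that $\Delta_k\ge c\,\epsilon$ for every $\epsilon>0$ and every $k<T_\epsilon$. -/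

import Mathlib

open MeasureTheory ProbabilityTheory Filter Asymptotics
open scoped Nat

noncomputable section

namespace AstroDF

/-- Euclidean space `ℝ^d`. -/
abbrev E (d : ℕ) : Type := EuclideanSpace ℝ (Fin d)

/-! ### Sample statistics and adaptive sample sizes -/

/-- Average of the first `n` observations `y 0, …, y (n-1)`. -/
def sampleMean (y : ℕ → ℝ) (n : ℕ) : ℝ := (∑ j ∈ Finset.range n, y j) / n

/-- Unbiased sample variance of the first `n` observations (meaningful for `n ≥ 2`). -/
def sampleVar (y : ℕ → ℝ) (n : ℕ) : ℝ :=
  (∑ j ∈ Finset.range n, (y j - sampleMean y n) ^ 2) / ((n : ℝ) - 1)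

/-- Adaptive sample size: the least `n ≥ lam` (for which the sample variance is defined, i.e.
`n ≥ 2`) such that the estimated standard error is at most `κ Δ² / √lam`. -/
def sampleSize (κ lam Δ : ℝ) (y : ℕ → ℝ) : ℕ :=
  sInf {n : ℕ | 2 ≤ n ∧ lam ≤ n ∧
    Real.sqrt (sampleVar y n) / Real.sqrt n ≤ κ * Δ ^ 2 / Real.sqrt lam}

/-- The estimate obtained by averaging the adaptively chosen number of observations. -/
def estimate (κ lam Δ : ℝ) (y : ℕ → ℝ) : ℝ := sampleMean y (sampleSize κ lam Δ y)

/-! ### Design set and local model -/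

/-- Labels of the `2d + 1` design points. -/
inductive DesignIdx (d : ℕ) : Type
  | center : DesignIdx d
  | plus (i : Fin d) : DesignIdx d
  | minus (i : Fin d) : DesignIdx d

/-- Direction of a design point from the incumbent: `0`, `e_i` or `-e_i`. -/
def DesignIdx.dir {d : ℕ} : DesignIdx d → E d
  | .center => 0
  | .plus i => EuclideanSpace.single i (1 : ℝ)
  | .minus i => -EuclideanSpace.single i (1 : ℝ)

/-- The diagonal Hessian with diagonal `h`, as an operator on `ℝ^d`; its norm is the spectral
norm. -/
def hess {d : ℕ} (h : Fin d → ℝ) : E d →L[ℝ] E d :=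
  Matrix.toEuclideanCLM (𝕜 := ℝ) (Matrix.diagonal h)

/-- The quadratic model with diagonal Hessian, `s ↦ β₀ + sᵀ g + ½ sᵀ H s`. -/
def quadModel {d : ℕ} (β₀ : ℝ) (g : E d) (h : Fin d → ℝ) (s : E d) : ℝ :=
  β₀ + inner ℝ s g + (1 / 2) * inner ℝ s (hess h s)

/-- `s` is a Cauchy step of the model in the ball of radius `Δ`: it achieves at least the Cauchy
reduction `½ ‖g‖ (‖g‖ / ‖H‖ ∧ Δ)`, where `‖g‖ / ‖H‖ = +∞` if `H = 0`. -/
def IsCauchyStep {d : ℕ} (β₀ : ℝ) (g : E d) (h : Fin d → ℝ) (Δ : ℝ) (s : E d) : Prop :=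
  ‖s‖ ≤ Δ ∧
    (1 / 2) * ‖g‖ * (if ‖hess h‖ = 0 then Δ else min (‖g‖ / ‖hess h‖) Δ)
      ≤ quadModel β₀ g h 0 - quadModel β₀ g h s

/-! ### The algorithm -/

/-- User-chosen constants of the algorithm. -/
structure Params where
  /-- initial trust-region radius -/
  Δ₀ : ℝ
  /-- maximal trust-region radius -/
  Δmax : ℝ
  /-- model fitness threshold -/
  η : ℝ
  /-- sufficient reduction constant of the direct search -/
  θ : ℝ
  /-- expansion constant -/
  γ₁ : ℝ
  /-- shrinkage constant -/
  γ₂ : ℝ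
  /-- adaptive sampling constant -/
  κ : ℝ
  /-- criticality threshold -/
  μ : ℝ
  /-- lower bounds for the sample sizes -/
  lam : ℕ → ℝ
  Δ₀_pos : 0 < Δ₀
  Δmax_pos : 0 < Δmax
  η_mem : η ∈ Set.Ioo (0 : ℝ) 1
  θ_pos : 0 < θ
  one_lt_γ₁ : 1 < γ₁
  γ₂_mem : γ₂ ∈ Set.Ioo (0 : ℝ) 1
  κ_pos : 0 < κ
  μ_pos : 0 < μ
  lam_pos : ∀ k, 0 < lam k

/-- The random quantities that occur in a run of the algorithm (without their laws, which are
imposed by `IsTrajectory`). The points sampled in an iteration are labelled by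
`Option (DesignIdx d)`, where `none` labels the candidate proposed by the model. -/
structure Run (d : ℕ) (Ω Ξ : Type*) where
  /-- incumbents -/
  X : ℕ → Ω → E d
  /-- trust-region radii -/
  Δ : ℕ → Ω → ℝ
  /-- constant coefficients of the models -/
  β₀ : ℕ → Ω → ℝ
  /-- model gradients at the incumbents -/
  G : ℕ → Ω → E d
  /-- diagonals of the model Hessians -/
  h : ℕ → Ω → Fin d → ℝ
  /-- steps obtained from the trust-region subproblems -/
  S : ℕ → Ω → E d
  /-- labels of design points with the smallest estimates -/
  best : ℕ → Ω → DesignIdx d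
  /-- random input of the `j`-th oracle call at the given point in the given iteration -/
  ξ : ℕ → Option (DesignIdx d) → ℕ → Ω → Ξ

/-- The objective `f(x) = 𝔼 F(x, ξ)`. -/
def objective {d : ℕ} {Ξ : Type*} [MeasurableSpace Ξ] (F : E d → Ξ → ℝ) (P : Measure Ξ)
    (x : E d) : ℝ := ∫ z, F x z ∂P

namespace Run

variable {d : ℕ} {Ω Ξ : Type*}

/-- The points sampled in iteration `k`. -/
def point (r : Run d Ω Ξ) (k : ℕ) (i : Option (DesignIdx d)) (ω : Ω) : E d :=
  match i with
  | some i => r.X k ω + r.Δ k ω • i.dir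
  | none => r.X k ω + r.S k ω

/-- The `j`-th oracle output at the point labelled `i` in iteration `k`. -/
def obs (r : Run d Ω Ξ) (F : E d → Ξ → ℝ) (k : ℕ) (i : Option (DesignIdx d)) (j : ℕ)
    (ω : Ω) : ℝ := F (r.point k i ω) (r.ξ k i j ω)

/-- The stochastic error of the `j`-th oracle output. -/
def err [MeasurableSpace Ξ] (r : Run d Ω Ξ) (F : E d → Ξ → ℝ) (P : Measure Ξ) (k : ℕ)
    (i : Option (DesignIdx d)) (j : ℕ) (ω : Ω) : ℝ :=
  r.obs F k i j ω - objective F P (r.point k i ω)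

/-- The function estimate at the point labelled `i` in iteration `k`. -/
def Fbar (r : Run d Ω Ξ) (par : Params) (F : E d → Ξ → ℝ) (k : ℕ)
    (i : Option (DesignIdx d)) (ω : Ω) : ℝ :=
  estimate par.κ (par.lam k) (r.Δ k ω) (fun j => r.obs F k i j ω)

/-- The model of iteration `k`, as a function of the displacement from the incumbent. -/
def model (r : Run d Ω Ξ) (k : ℕ) (ω : Ω) (s : E d) : ℝ :=
  quadModel (r.β₀ k ω) (r.G k ω) (r.h k ω) s

/-- Direct search reduction. -/
def redDirect (r : Run d Ω Ξ) (par : Params) (F : E d → Ξ → ℝ) (k : ℕ) (ω : Ω) : ℝ :=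
  r.Fbar par F k (some .center) ω - r.Fbar par F k (some (r.best k ω)) ω

/-- Subproblem reduction. -/
def redSub (r : Run d Ω Ξ) (par : Params) (F : E d → Ξ → ℝ) (k : ℕ) (ω : Ω) : ℝ :=
  r.Fbar par F k (some .center) ω - r.Fbar par F k none ω

/-- Model reduction. -/
def redModel (r : Run d Ω Ξ) (k : ℕ) (ω : Ω) : ℝ :=
  r.model k ω 0 - r.model k ω (r.S k ω)

/-- Acceptance test for the best design point. -/
def DirectTest (r : Run d Ω Ξ) (par : Params) (F : E d → Ξ → ℝ) (k : ℕ) (ω : Ω) : Prop :=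
  max (r.redSub par F k ω) (par.θ * r.Δ k ω ^ 2) < r.redDirect par F k ω

/-- Acceptance test for the candidate of the subproblem. -/
def ModelTest (r : Run d Ω Ξ) (par : Params) (F : E d → Ξ → ℝ) (k : ℕ) (ω : Ω) : Prop :=
  par.η * r.redModel k ω ≤ r.redSub par F k ω ∧ r.Δ k ω ≤ par.μ * ‖r.G k ω‖

/-- Iteration `k` is successful: one of the two candidates is accepted. -/
def Successful (r : Run d Ω Ξ) (par : Params) (F : E d → Ξ → ℝ) (k : ℕ) (ω : Ω) : Prop :=
  r.DirectTest par F k ω ∨ r.ModelTest par F k ω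

/-- The sample path `ω` of `r` is generated by the algorithm started at `x₀`. -/
structure IsTrajectory (r : Run d Ω Ξ) (par : Params) (F : E d → Ξ → ℝ) (x₀ : E d)
    (ω : Ω) : Prop where
  init_X : r.X 0 ω = x₀
  init_Δ : r.Δ 0 ω = par.Δ₀
  /-- the model interpolates the estimates at the design points -/
  interpolates : ∀ k (i : DesignIdx d),
    r.model k ω (r.Δ k ω • i.dir) = r.Fbar par F k (some i) ω
  /-- the step stays in the trust region -/
  step_le : ∀ k, ‖r.S k ω‖ ≤ r.Δ k ω
  best_le : ∀ k (i : DesignIdx d),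
    r.Fbar par F k (some (r.best k ω)) ω ≤ r.Fbar par F k (some i) ω
  update_direct : ∀ k, r.DirectTest par F k ω →
    r.X (k + 1) ω = r.point k (some (r.best k ω)) ω ∧
      r.Δ (k + 1) ω = min (par.γ₁ * r.Δ k ω) par.Δmax
  update_model : ∀ k, ¬ r.DirectTest par F k ω → r.ModelTest par F k ω →
    r.X (k + 1) ω = r.point k none ω ∧
      r.Δ (k + 1) ω = min (par.γ₁ * r.Δ k ω) par.Δmax
  update_fail : ∀ k, ¬ r.DirectTest par F k ω → ¬ r.ModelTest par F k ω →
    r.X (k + 1) ω = r.X k ω ∧ r.Δ (k + 1) ω = par.γ₂ * r.Δ k ω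

/-- The first-order `ε`-stationary stopping time `min {k : ‖∇f(X_k)‖ ≤ ε}` (`⊤` if there is no
such `k`). -/
def stopTime (r : Run d Ω Ξ) (f : E d → ℝ) (ε : ℝ) (ω : Ω) : ℕ∞ :=
  sInf ((fun k : ℕ => (k : ℕ∞)) '' {k : ℕ | ‖gradient f (r.X k ω)‖ ≤ ε})

end Run

/-! ### Assumptions -/

/-- `f` is `C²` on the open set `U` with Lipschitz gradient and Lipschitz Hessian there. -/
structure SmoothOn {d : ℕ} (f : E d → ℝ) (U : Set (E d)) : Prop where
  isOpen : IsOpen U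
  contDiffOn : ContDiffOn ℝ 2 f U
  lipschitz_gradient : ∃ κLg : NNReal, LipschitzOnWith κLg (gradient f) U
  lipschitz_hessian : ∃ κL : NNReal, LipschitzOnWith κL (fderiv ℝ (gradient f)) U

/-- The oracle: `𝓕 k` is the information available before sampling in iteration `k`. At every
sampled point of an iteration the errors are iid with zero mean and Bernstein-type moments, and
are independent of `𝓕 k`; their law is the same in all iterations. Nothing is required about the
dependence between errors at different points of the same iteration. -/
structure OracleAssumption {d : ℕ} {Ω Ξ : Type*} [MeasurableSpace Ξ] {mΩ : MeasurableSpace Ω}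
    (Pr : Measure Ω) (𝓕 : Filtration ℕ mΩ) (F : E d → Ξ → ℝ) (P : Measure Ξ)
    (r : Run d Ω Ξ) : Prop where
  integrable_F : ∀ x, Integrable (F x) P
  measurable_ξ : ∀ k i j, Measurable (r.ξ k i j)
  law_ξ : ∀ k i j, Measure.map (r.ξ k i j) Pr = P
  measurable_X : ∀ k, Measurable[𝓕 k] (r.X k)
  measurable_Δ : ∀ k, Measurable[𝓕 k] (r.Δ k)
  measurable_err : ∀ k i j, Measurable[𝓕 (k + 1)] (r.err F P k i j)
  identDistrib : ∀ k i j, IdentDistrib (r.err F P k i j) (r.err F P 0 i 0) Pr Pr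
  iIndep : ∀ k i, iIndepFun (fun j => r.err F P k i j) Pr
  indep_past : ∀ k i, Indep
    (MeasurableSpace.comap (fun ω j => r.err F P k i j ω) (inferInstance : MeasurableSpace (ℕ → ℝ)))
    (𝓕 k) Pr
  mean_zero : ∀ k i j, ∫ ω, r.err F P k i j ω ∂Pr = 0
  moments : ∃ σ b : ℝ, 0 < σ ∧ 0 < b ∧ ∀ k i j, ∀ m : ℕ, 2 ≤ m →
    Integrable (fun ω => |r.err F P k i j ω| ^ m) Pr ∧
      ∫ ω, |r.err F P k i j ω| ^ m ∂Pr ≤ (m ! : ℝ) / 2 * b ^ (m - 2) * σ ^ 2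

/-- Fraction of Cauchy decrease, and bounded model Hessians, almost surely. -/
structure ModelAssumption {d : ℕ} {Ω Ξ : Type*} {mΩ : MeasurableSpace Ω}
    (Pr : Measure Ω) (r : Run d Ω Ξ) : Prop where
  cauchy : ∃ κfcd ∈ Set.Ioc (0 : ℝ) 1, ∀ᵐ ω ∂Pr, ∀ k, ∃ Sc : E d,
    IsCauchyStep (r.β₀ k ω) (r.G k ω) (r.h k ω) (r.Δ k ω) Sc ∧
      κfcd * (r.model k ω 0 - r.model k ω Sc) ≤ r.model k ω 0 - r.model k ω (r.S k ω)
  hess_bdd : ∃ κH : ℝ, 0 < κH ∧ ∀ᵐ ω ∂Pr, ∀ k, ‖hess (r.h k ω)‖ ≤ κH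

/-- `(log k)^(1+ε) = O(lam k)` for some `ε ∈ (0,1)`. -/
def LambdaAssumption (lam : ℕ → ℝ) : Prop :=
  ∃ εl ∈ Set.Ioo (0 : ℝ) 1,
    (fun k : ℕ => Real.log (k : ℝ) ^ (1 + εl)) =O[atTop] lam

end AstroDF

end

noncomputable section

namespace AstroDF

/-! ### Exponential moments -/

/-! The crux is that, almost surely, all estimates are eventually accurate to within `Δ_k²`. The
sample size depends on the data it averages and on the random radius, so the bound is proved for all
sample sizes and all admissible radii at once: radii decay at most geometrically, `Δ_k ≥ D q^k`.

Let `v > 0` be the error variance at a label (if `v = 0` the errors vanish). Bernstein moments make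
the errors sub-exponential, and Doob's inequality bounds all partial sums up to `2^m ≥ λ_k` by
`√(β(λ_k/2^m + (D q^k)^4)) 2^m`, outside an event of probability at most `2 exp(-a λ_k) exp(-a (D
q^k)^4 2^m)` with `a = β/(4V)`. Summed over `m` the last factor is at most linear in `k`, and `λ_k`
eventually exceeds every multiple of `log k`, so Borel–Cantelli applies
(`ae_eventually_abs_sum_le`). Sums of squares are treated likewise, so the sample variance at the
stopping size `N` is at least `v/4`. The stopping rule then forces `λ_k/N ≤ (4κ²/v) Δ⁴`, the squared
mean is at most `4β(λ_k/N + (D q^k)^4)`, and a small `β` gives any accuracy `c Δ²`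
(`ae_eventually_abs_estimate_le`).

The rest is deterministic. Interpolating such estimates gives an `O(Δ)` gradient error and an
`O(Δ²)` model error. If `‖∇f(X_k)‖ ≥ A Δ_k` with `A` large, the Cauchy decrease, of order `‖G_k‖
Δ_k`, dominates these errors and the model test passes (`Run.IsTrajectory.successful_of_accurate`);
hence `c_lb = 1/A`. Past `K_E`, failures occur only at radii at least `c_lb ε`, which yields the
lower bound on the radii. -/

lemma exp_le_one_add_add_sq_mul_exp_abs (x : ℝ) :
    Real.exp x ≤ 1 + x + x ^ 2 * Real.exp |x| := by
  have h1 : (1 : ℝ) ≤ Real.exp |x| := Real.one_le_exp (abs_nonneg x)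
  rcases le_or_gt |x| 1 with h | h
  · have h2 := (abs_le.1 (Real.abs_exp_sub_one_sub_id_le h)).2
    nlinarith [sq_nonneg x]
  · rcases lt_abs.1 h with h | h
    · rw [abs_of_pos (by linarith)] at h1 ⊢
      nlinarith [Real.exp_pos x, mul_pos (by nlinarith : 0 < x ^ 2 - 1) (Real.exp_pos x)]
    · have : Real.exp x ≤ 1 := Real.exp_le_one_iff.2 (by linarith)
      nlinarith [sq_nonneg x]

section Moments

variable {Ω : Type*} [MeasurableSpace Ω] {μ : Measure Ω} {Z : Ω → ℝ}

/-- Bernstein moments give an exponential moment. -/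
lemma exists_integrable_exp_mul_abs [IsProbabilityMeasure μ] {σ b : ℝ} (hb : 0 < b) (hZ : Measurable Z)
    (hmom : ∀ m : ℕ, 2 ≤ m → Integrable (fun ω => |Z ω| ^ m) μ ∧
      ∫ ω, |Z ω| ^ m ∂μ ≤ (m ! : ℝ) / 2 * b ^ (m - 2) * σ ^ 2) :
    ∃ s : ℝ, 0 < s ∧ Integrable (fun ω => Real.exp (s * |Z ω|)) μ := by
  -- The moment bounds start at order 2; `|Z|^m ≤ 1 + |Z|^(m+2)` covers orders 0 and 1.
  have hint : ∀ m : ℕ, Integrable (fun ω => |Z ω| ^ m) μ := by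
    intro m
    refine Integrable.mono' ((integrable_const (1 : ℝ)).add (hmom (m + 2) (by omega)).1)
      (by fun_prop) (ae_of_all _ fun ω => ?_)
    simp only [Real.norm_eq_abs, abs_pow, abs_abs, Pi.add_apply]
    rcases le_total |Z ω| 1 with h | h
    · have := pow_le_one₀ (n := m) (abs_nonneg _) h
      have : 0 ≤ |Z ω| ^ (m + 2) := by positivity
      linarith
    · have := pow_le_pow_right₀ h (show m ≤ m + 2 by omega)
      linarith
  -- The factorials cancel against the exponential series, and this `s` makes the remaining terms
  -- geometric of ratio `s b = 1/2`.
  set s : ℝ := 1 / (2 * b) with hs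
  have hs0 : 0 < s := by positivity
  set f : ℕ → Ω → ℝ := fun m ω => (s * |Z ω|) ^ m / (m ! : ℝ) with hf
  have hf0 : ∀ m ω, 0 ≤ f m ω := fun m ω => by positivity
  have hfint : ∀ m, Integrable (f m) μ := by
    intro m
    simp only [hf, mul_pow]
    exact ((hint m).const_mul _).div_const _
  have hsum : Summable fun m => ∫ ω, f m ω ∂μ := by
    rw [← summable_nat_add_iff 2]
    refine Summable.of_nonneg_of_le (fun m => integral_nonneg (hf0 _)) (fun m => ?_)
      ((summable_geometric_of_lt_one (by norm_num : (0 : ℝ) ≤ 1 / 2) (by norm_num)).mul_left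
        (s ^ 2 * σ ^ 2 / 2))
    have h1 : ∫ ω, f (m + 2) ω ∂μ = s ^ (m + 2) / ((m + 2)! : ℝ) * ∫ ω, |Z ω| ^ (m + 2) ∂μ := by
      rw [← integral_const_mul]
      refine integral_congr_ae (ae_of_all _ fun ω => ?_)
      simp only [hf, mul_pow]
      ring
    have h2 := (hmom (m + 2) (by omega)).2
    rw [h1]
    calc s ^ (m + 2) / ((m + 2)! : ℝ) * ∫ ω, |Z ω| ^ (m + 2) ∂μ
        ≤ s ^ (m + 2) / ((m + 2)! : ℝ) *
            (((m + 2)! : ℝ) / 2 * b ^ (m + 2 - 2) * σ ^ 2) := by gcongr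
      _ = s ^ 2 * σ ^ 2 / 2 * (s * b) ^ m := by
          have : ((m + 2)! : ℝ) ≠ 0 := by positivity
          rw [Nat.add_sub_cancel, mul_pow, pow_add]
          field_simp
      _ = s ^ 2 * σ ^ 2 / 2 * (1 / 2) ^ m := by
          congr 2
          rw [hs]
          field_simp
  refine ⟨s, hs0, by fun_prop, ?_⟩
  rw [hasFiniteIntegral_iff_ofReal (ae_of_all _ fun ω => (Real.exp_pos _).le)]
  have hexp : ∀ ω, ENNReal.ofReal (Real.exp (s * |Z ω|)) = ∑' m, ENNReal.ofReal (f m ω) := by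
    intro ω
    rw [← ENNReal.ofReal_tsum_of_nonneg (fun m => hf0 m ω)
      (Real.summable_pow_div_factorial _), Real.exp_eq_exp_ℝ, NormedSpace.exp_eq_tsum_div]
  simp_rw [hexp]
  rw [lintegral_tsum (fun m => (hfint m).aemeasurable.ennreal_ofReal)]
  have : ∀ m, ∫⁻ ω, ENNReal.ofReal (f m ω) ∂μ = ENNReal.ofReal (∫ ω, f m ω ∂μ) := fun m =>
    (ofReal_integral_eq_lintegral_ofReal (hfint m) (ae_of_all _ (hf0 m))).symm
  simp_rw [this]
  exact (Summable.tsum_ofReal_ne_top hsum).lt_top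

lemma integrable_exp_mul_of_integrable_exp_abs {s t : ℝ} (hZ : Measurable Z)
    (h : Integrable (fun ω => Real.exp (s * |Z ω|)) μ) (ht : |t| ≤ s) :
    Integrable (fun ω => Real.exp (t * Z ω)) μ := by
  refine h.mono' (by fun_prop) (ae_of_all _ fun ω => ?_)
  rw [Real.norm_eq_abs, Real.abs_exp, Real.exp_le_exp]
  calc t * Z ω ≤ |t * Z ω| := le_abs_self _
    _ = |t| * |Z ω| := abs_mul _ _
    _ ≤ s * |Z ω| := by gcongr

/-- The spare exponent `s - t` absorbs the power, since `x^m / m! ≤ exp x`. The case `t = 0`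
supplies all moments. -/
lemma integrable_pow_mul_exp_abs {s t : ℝ} (hZ : Measurable Z)
    (h : Integrable (fun ω => Real.exp (s * |Z ω|)) μ) (hts : t < s) (m : ℕ) :
    Integrable (fun ω => |Z ω| ^ m * Real.exp (t * |Z ω|)) μ := by
  have hst : 0 < s - t := by linarith
  refine (h.const_mul ((m ! : ℝ) / (s - t) ^ m)).mono' (by fun_prop) (ae_of_all _ fun ω => ?_)
  rw [Real.norm_eq_abs, abs_of_nonneg (by positivity)]
  have h1 := Real.pow_div_factorial_le_exp ((s - t) * |Z ω|) (by positivity) m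
  have h2 : s * |Z ω| = (s - t) * |Z ω| + t * |Z ω| := by ring
  rw [h2, Real.exp_add, ← mul_assoc]
  gcongr
  rw [div_le_iff₀ (by positivity), mul_pow] at h1
  rw [div_mul_eq_mul_div, le_div_iff₀ (by positivity)]
  linarith

/-- A centered variable with an exponential moment is sub-exponential. -/
lemma exists_mgf_le_exp_sq [IsProbabilityMeasure μ] {s₁ : ℝ} (hs₁ : 0 < s₁) (hZ : Measurable Z)
    (h : Integrable (fun ω => Real.exp (s₁ * |Z ω|)) μ) (hmean : ∫ ω, Z ω ∂μ = 0) :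
    ∃ s V : ℝ, 0 < s ∧ 0 < V ∧ ∀ t : ℝ, |t| ≤ s →
      Integrable (fun ω => Real.exp (t * Z ω)) μ ∧ mgf Z μ t ≤ Real.exp (V * t ^ 2) := by
  have hint2 := integrable_pow_mul_exp_abs hZ h (show s₁ / 2 < s₁ by linarith) 2
  have hint1 : Integrable Z μ := by
    have := integrable_pow_mul_exp_abs hZ h hs₁ 1
    simp only [pow_one, zero_mul, Real.exp_zero, mul_one] at this
    exact this.mono' (by fun_prop) (ae_of_all _ fun ω => le_rfl)
  set V : ℝ := ∫ ω, |Z ω| ^ 2 * Real.exp (s₁ / 2 * |Z ω|) ∂μ with hV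
  have hV0 : 0 ≤ V := integral_nonneg fun ω => by positivity
  -- Halving `s₁` leaves room for the factor `Z²` in `V`; `+ 1` makes the constant positive.
  refine ⟨s₁ / 2, V + 1, by positivity, by positivity, fun t ht => ?_⟩
  have hintt := integrable_exp_mul_of_integrable_exp_abs hZ h (t := t) (by linarith)
  refine ⟨hintt, ?_⟩
  have h1 : mgf Z μ t ≤ 1 + t ^ 2 * V := by
    calc mgf Z μ t
        ≤ ∫ ω, (1 + t * Z ω + t ^ 2 * (|Z ω| ^ 2 * Real.exp (s₁ / 2 * |Z ω|))) ∂μ := by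
          refine integral_mono hintt (((integrable_const _).add (hint1.const_mul t)).add
            (hint2.const_mul _)) fun ω => ?_
          have h3 := exp_le_one_add_add_sq_mul_exp_abs (t * Z ω)
          refine h3.trans ?_
          rw [mul_pow, ← sq_abs (Z ω), mul_assoc, abs_mul]
          gcongr
      _ = 1 + t ^ 2 * V := by
          rw [integral_add (f := fun ω => 1 + t * Z ω)
            ((integrable_const _).add (hint1.const_mul t)) (hint2.const_mul _), integral_add (integrable_const _) (hint1.const_mul t),
            integral_const_mul, integral_const_mul, hmean]
          simp [hV]
  calc mgf Z μ t ≤ 1 + t ^ 2 * V := h1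
    _ ≤ (V + 1) * t ^ 2 + 1 := by nlinarith [sq_nonneg t]
    _ ≤ _ := Real.add_one_le_exp _

/-- The lower tail of the second moment is exponentially small. -/
lemma exists_mgf_neg_sq_le [IsProbabilityMeasure μ] {s₁ : ℝ} (hs₁ : 0 < s₁) (hZ : Measurable Z)
    (h : Integrable (fun ω => Real.exp (s₁ * |Z ω|)) μ) {v : ℝ} (hv : ∫ ω, Z ω ^ 2 ∂μ = v)
    (hv0 : 0 < v) :
    ∃ t a : ℝ, 0 < t ∧ 0 < a ∧
      mgf (fun ω => Z ω ^ 2) μ (-t) ≤ Real.exp (-(t * (v / 2)) - a) := by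
  have hint : ∀ m, Integrable (fun ω => |Z ω| ^ m) μ := fun m => by
    simpa using integrable_pow_mul_exp_abs hZ h hs₁ m
  have hint2 : Integrable (fun ω => Z ω ^ 2) μ := by simpa using hint 2
  have hint4 : Integrable (fun ω => Z ω ^ 4) μ := by
    have := hint 4
    simpa only [show ∀ ω, |Z ω| ^ 4 = Z ω ^ 4 from fun ω => Even.pow_abs (by decide) _] using this
  set w : ℝ := ∫ ω, Z ω ^ 4 ∂μ with hw
  have hw0 : 0 ≤ w := integral_nonneg fun ω => by positivity
  -- Chosen so that `t² w ≤ t v / 4`: of the decrease `t v` in the expansion, `t v / 2` pays for the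
  -- threshold and `t v / 4` remains as `a`.
  set t : ℝ := v / (4 * (w + 1)) with ht
  have ht0 : 0 < t := by positivity
  have hexp : ∀ x : ℝ, 0 ≤ x → Real.exp (-x) ≤ 1 - x + x ^ 2 := by
    intro x hx
    rcases le_or_gt x 1 with h1 | h1
    · have := (abs_le.1 (Real.abs_exp_sub_one_sub_id_le (x := -x)
        (by rw [abs_neg, abs_of_nonneg hx]; exact h1))).2
      linarith [neg_sq x]
    · have : Real.exp (-x) ≤ 1 := Real.exp_le_one_iff.2 (by linarith)
      nlinarith
  refine ⟨t, t * v / 4, ht0, by positivity, ?_⟩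
  have h1 : mgf (fun ω => Z ω ^ 2) μ (-t) ≤ 1 - t * v + t ^ 2 * w := by
    calc mgf (fun ω => Z ω ^ 2) μ (-t)
        ≤ ∫ ω, (1 - t * Z ω ^ 2 + t ^ 2 * Z ω ^ 4) ∂μ := by
          refine integral_mono_of_nonneg (ae_of_all _ fun ω => (Real.exp_pos _).le)
            (((integrable_const _).sub (hint2.const_mul t)).add (hint4.const_mul _))
            (ae_of_all _ fun ω => ?_)
          have h3 := hexp (t * Z ω ^ 2) (by positivity)
          have h4 : -t * Z ω ^ 2 = -(t * Z ω ^ 2) := by ring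
          simp only [h4]
          refine h3.trans (le_of_eq ?_)
          ring
      _ = 1 - t * v + t ^ 2 * w := by
          rw [integral_add (f := fun ω => 1 - t * Z ω ^ 2)
            ((integrable_const _).sub (hint2.const_mul t)) (hint4.const_mul _), integral_sub (integrable_const _) (hint2.const_mul t),
            integral_const_mul, integral_const_mul, hv]
          simp [hw]
  have h2 : t * (4 * (w + 1)) = v := by
    rw [ht]; field_simp
  calc mgf (fun ω => Z ω ^ 2) μ (-t) ≤ 1 - t * v + t ^ 2 * w := h1
    _ ≤ (-(t * (v / 2)) - t * v / 4) + 1 := by nlinarith [sq_nonneg t]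
    _ ≤ _ := Real.add_one_le_exp _

end Moments

/-! ### Maximal inequality for sums of iid variables -/

section Maximal

variable {Ω : Type*} [MeasurableSpace Ω] {μ : Measure Ω} {Z : Ω → ℝ}
  {Y : ℕ → Ω → ℝ}

lemma mgf_sum_range_eq_pow (hY : ∀ j, Measurable (Y j)) (hind : iIndepFun Y μ)
    (hid : ∀ j, IdentDistrib (Y j) Z μ μ) (t : ℝ) (n : ℕ) :
    mgf (fun ω => ∑ j ∈ Finset.range n, Y j ω) μ t = mgf Z μ t ^ n := by
  have h1 : (fun ω => ∑ j ∈ Finset.range n, Y j ω) = ∑ j ∈ Finset.range n, Y j := by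
    ext ω; simp
  rw [h1, hind.mgf_sum hY, Finset.prod_congr rfl fun j _ => mgf_congr_of_identDistrib _ _ (hid j) t]
  simp

lemma integrable_exp_mul_sum_range [IsFiniteMeasure μ] (hY : ∀ j, Measurable (Y j)) (hind : iIndepFun Y μ)
    (hid : ∀ j, IdentDistrib (Y j) Z μ μ) {t : ℝ}
    (hint : Integrable (fun ω => Real.exp (t * Z ω)) μ) (n : ℕ) :
    Integrable (fun ω => Real.exp (t * ∑ j ∈ Finset.range n, Y j ω)) μ := by
  have := hind.integrable_exp_mul_sum hY (s := Finset.range n) (t := t) fun j _ =>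
    ((hid j).comp (u := fun x => Real.exp (t * x)) (by fun_prop)).integrable_iff.2 hint
  simpa using this

/-- Each new independent factor has mean `mgf Z μ s`, which is at least 1 because `Z` is centered.
The shift to `n + 1` summands makes the process adapted to the natural filtration, where time `n`
already reveals `Y n`. -/
lemma submartingale_exp_mul_sum [IsProbabilityMeasure μ] (hY : ∀ j, Measurable (Y j)) (hind : iIndepFun Y μ)
    (hid : ∀ j, IdentDistrib (Y j) Z μ μ) {s : ℝ}
    (hint : Integrable (fun ω => Real.exp (s * Z ω)) μ) (hZ : Integrable Z μ)
    (hmean : ∫ ω, Z ω ∂μ = 0) :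
    Submartingale (fun n ω => Real.exp (s * ∑ j ∈ Finset.range (n + 1), Y j ω))
      (Filtration.natural Y fun j => (hY j).stronglyMeasurable) μ := by
  set 𝒢 := Filtration.natural Y fun j => (hY j).stronglyMeasurable with h𝒢
  have hadp : ∀ n, StronglyMeasurable[𝒢 n]
      (fun ω => Real.exp (s * ∑ j ∈ Finset.range (n + 1), Y j ω)) := by
    intro n
    have h1 : StronglyMeasurable[𝒢 n] (fun ω => ∑ j ∈ Finset.range (n + 1), Y j ω) := by
      have h2 : ∀ j ∈ Finset.range (n + 1), StronglyMeasurable[𝒢 n] (Y j) := fun j hj =>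
        ((Filtration.stronglyAdapted_natural fun j => (hY j).stronglyMeasurable) j).mono
          (𝒢.mono (by simpa [Nat.lt_succ_iff] using hj))
      exact Finset.stronglyMeasurable_fun_sum _ h2
    exact Real.continuous_exp.comp_stronglyMeasurable (h1.const_mul s)
  refine submartingale_nat hadp
    (fun n => integrable_exp_mul_sum_range hY hind hid hint (n + 1)) fun n => ?_
  have hintY : Integrable (fun ω => Real.exp (s * Y (n + 1) ω)) μ :=
    ((hid (n + 1)).comp (u := fun x => Real.exp (s * x)) (by fun_prop)).integrable_iff.2 hint
  have hfact : (fun ω => Real.exp (s * ∑ j ∈ Finset.range (n + 1 + 1), Y j ω)) =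
      (fun ω => Real.exp (s * ∑ j ∈ Finset.range (n + 1), Y j ω)) *
        fun ω => Real.exp (s * Y (n + 1) ω) := by
    ext ω
    rw [Pi.mul_apply, Finset.sum_range_succ, mul_add, Real.exp_add]
  have hpull := condExp_mul_of_stronglyMeasurable_left (hadp n)
    (by rw [← hfact]; exact integrable_exp_mul_sum_range hY hind hid hint (n + 1 + 1)) hintY
  have hcond : μ[fun ω => Real.exp (s * Y (n + 1) ω) | 𝒢 n] =ᵐ[μ] fun _ => mgf Z μ s := by
    refine (condExp_indep_eq (m₁ := MeasurableSpace.comap (Y (n + 1)) inferInstance)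
      (hY (n + 1)).comap_le (𝒢.le n) ?_
      (hind.indep_comap_natural_of_lt (fun j => (hY j).stronglyMeasurable) n.lt_succ_self)).trans ?_
    · exact Real.continuous_exp.comp_stronglyMeasurable
        ((comap_measurable (Y (n + 1))).stronglyMeasurable.const_mul s)
    · refine ae_of_all _ fun _ => ?_
      exact mgf_congr_of_identDistrib _ _ (hid (n + 1)) s
  have hone : 1 ≤ mgf Z μ s := by
    calc (1 : ℝ) = ∫ ω, (s * Z ω + 1) ∂μ := by
          rw [integral_add (hZ.const_mul s) (integrable_const _), integral_const_mul, hmean]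
          simp
      _ ≤ mgf Z μ s := integral_mono ((hZ.const_mul s).add (integrable_const _)) hint
          fun ω => Real.add_one_le_exp _
  change _ ≤ᵐ[μ] μ[fun ω => Real.exp (s * ∑ j ∈ Finset.range (n + 1 + 1), Y j ω) | 𝒢 n]
  rw [hfact]
  filter_upwards [hpull, hcond] with ω h1 h2
  rw [h1, Pi.mul_apply, h2]
  exact le_mul_of_one_le_right (Real.exp_pos _).le hone

/-- Doob's maximal inequality: controlling all partial sums costs no more than the Chernoff bound
for the last one. -/
lemma measure_exists_sum_ge_le [IsProbabilityMeasure μ] (hY : ∀ j, Measurable (Y j)) (hind : iIndepFun Y μ)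
    (hid : ∀ j, IdentDistrib (Y j) Z μ μ) {s : ℝ} (hs : 0 ≤ s)
    (hint : Integrable (fun ω => Real.exp (s * Z ω)) μ) (hZ : Integrable Z μ)
    (hmean : ∫ ω, Z ω ∂μ = 0) (t : ℝ) (M : ℕ) :
    μ {ω | ∃ n ≤ M, t ≤ ∑ j ∈ Finset.range (n + 1), Y j ω} ≤
      ENNReal.ofReal (Real.exp (-s * t) * mgf Z μ s ^ (M + 1)) := by
  have hsub := submartingale_exp_mul_sum hY hind hid hint hZ hmean
  have hmax := maximal_ineq hsub (fun n ω => (Real.exp_pos _).le)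
    (ε := (Real.exp (s * t)).toNNReal) M
  rw [Real.coe_toNNReal _ (Real.exp_pos _).le] at hmax
  set A := {ω | Real.exp (s * t) ≤ (Finset.range (M + 1)).sup' Finset.nonempty_range_add_one
    fun k => Real.exp (s * ∑ j ∈ Finset.range (k + 1), Y j ω)} with hA
  have hsubset : {ω | ∃ n ≤ M, t ≤ ∑ j ∈ Finset.range (n + 1), Y j ω} ⊆ A := by
    rintro ω ⟨n, hn, hle⟩
    refine le_trans ?_ (Finset.le_sup' (fun k => Real.exp (s * ∑ j ∈ Finset.range (k + 1), Y j ω))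
      (Finset.mem_range.2 (Nat.lt_succ_of_le hn)))
    gcongr
  have hintM := integrable_exp_mul_sum_range hY hind hid hint (M + 1)
  have hle : ENNReal.ofReal (Real.exp (s * t)) * μ A ≤ ENNReal.ofReal (mgf Z μ s ^ (M + 1)) := by
    refine hmax.trans (ENNReal.ofReal_le_ofReal ?_)
    rw [← mgf_sum_range_eq_pow hY hind hid s (M + 1)]
    exact setIntegral_le_integral hintM (ae_of_all _ fun ω => (Real.exp_pos _).le)
  refine (measure_mono hsubset).trans ?_
  have h1 : μ A = ENNReal.ofReal (Real.exp (-s * t)) *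
      (ENNReal.ofReal (Real.exp (s * t)) * μ A) := by
    rw [← mul_assoc, ← ENNReal.ofReal_mul (Real.exp_pos _).le, ← Real.exp_add]
    simp
  rw [h1, ENNReal.ofReal_mul (Real.exp_pos _).le]
  gcongr

/-- Two-sided maximal inequality in the Gaussian range. -/
lemma measure_exists_abs_sum_ge_le [IsProbabilityMeasure μ] (hY : ∀ j, Measurable (Y j)) (hind : iIndepFun Y μ)
    (hid : ∀ j, IdentDistrib (Y j) Z μ μ) (hZ : Integrable Z μ) (hmean : ∫ ω, Z ω ∂μ = 0)
    {s V : ℝ} (hV : 0 < V) (hmgf : ∀ t : ℝ, |t| ≤ s →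
      Integrable (fun ω => Real.exp (t * Z ω)) μ ∧ mgf Z μ t ≤ Real.exp (V * t ^ 2))
    {u : ℝ} (hu : 0 ≤ u) (hus : u ≤ 2 * V * s) (M : ℕ) :
    μ {ω | ∃ n ≤ M, u * ((M : ℝ) + 1) ≤ |∑ j ∈ Finset.range (n + 1), Y j ω|} ≤
      2 * ENNReal.ofReal (Real.exp (-(u ^ 2 / (4 * V) * ((M : ℝ) + 1)))) := by
  -- The minimizer of `V t² - t u`, with value `-u² / (4 V)`; `hus` says that it stays within the
  -- range of `hmgf`.
  set t : ℝ := u / (2 * V) with ht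
  have ht0 : 0 ≤ t := by positivity
  have hts : t ≤ s := by
    rw [ht, div_le_iff₀ (by positivity)]; linarith
  have hbound : ∀ x : ℝ, x ≤ Real.exp (V * t ^ 2) → 0 ≤ x →
      Real.exp (-t * (u * ((M : ℝ) + 1))) * x ^ (M + 1) ≤
        Real.exp (-(u ^ 2 / (4 * V) * ((M : ℝ) + 1))) := by
    intro x hx hx0
    calc Real.exp (-t * (u * ((M : ℝ) + 1))) * x ^ (M + 1)
        ≤ Real.exp (-t * (u * ((M : ℝ) + 1))) * Real.exp (V * t ^ 2) ^ (M + 1) := by gcongr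
      _ = Real.exp (-(u ^ 2 / (4 * V) * ((M : ℝ) + 1))) := by
          rw [← Real.exp_nat_mul, ← Real.exp_add]
          congr 1
          rw [ht]
          push_cast
          field_simp
          ring
  have hpos := measure_exists_sum_ge_le hY hind hid ht0
    (hmgf t (by rwa [abs_of_nonneg ht0])).1 hZ hmean (u * ((M : ℝ) + 1)) M
  have hindn : iIndepFun (fun j ω => - Y j ω) μ :=
    hind.comp (fun _ x => -x) fun _ => measurable_neg
  have hidn : ∀ j, IdentDistrib (fun ω => - Y j ω) (fun ω => - Z ω) μ μ := fun j =>
    (hid j).comp measurable_neg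
  have hmn := hmgf (-t) (by rwa [abs_neg, abs_of_nonneg ht0])
  have hneg := measure_exists_sum_ge_le (fun j => (hY j).neg) hindn hidn ht0
    (by simpa using hmn.1) hZ.neg (by rw [integral_neg, hmean, neg_zero])
    (u * ((M : ℝ) + 1)) M
  have hmn2 : mgf (fun ω => - Z ω) μ t = mgf Z μ (-t) := mgf_neg
  rw [hmn2] at hneg
  refine (measure_mono (t := {ω | ∃ n ≤ M, u * ((M : ℝ) + 1) ≤ ∑ j ∈ Finset.range (n + 1), Y j ω} ∪
    {ω | ∃ n ≤ M, u * ((M : ℝ) + 1) ≤ ∑ j ∈ Finset.range (n + 1), - Y j ω}) ?_).trans ?_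
  · rintro ω ⟨n, hn, hle⟩
    rcases le_abs.1 hle with h | h
    · exact Or.inl ⟨n, hn, h⟩
    · exact Or.inr ⟨n, hn, by rwa [Finset.sum_neg_distrib]⟩
  · refine (measure_union_le _ _).trans ?_
    rw [two_mul]
    refine add_le_add (hpos.trans (ENNReal.ofReal_le_ofReal ?_))
      (hneg.trans (ENNReal.ofReal_le_ofReal ?_))
    · exact hbound _ (hmgf t (by rwa [abs_of_nonneg ht0])).2 mgf_nonneg
    · exact hbound _ (by simpa using hmn.2) mgf_nonneg

/-- Exponential lower tail bound for the sum of squares. -/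
lemma measure_sum_sq_le_le [IsProbabilityMeasure μ] (hY : ∀ j, Measurable (Y j)) (hind : iIndepFun Y μ)
    (hid : ∀ j, IdentDistrib (Y j) Z μ μ) (hZ : Measurable Z) {t a v : ℝ} (ht : 0 < t)
    (hmgf : mgf (fun ω => Z ω ^ 2) μ (-t) ≤ Real.exp (-(t * (v / 2)) - a)) (n : ℕ) :
    μ {ω | ∑ j ∈ Finset.range n, Y j ω ^ 2 ≤ v / 2 * n} ≤
      ENNReal.ofReal (Real.exp (-(a * n))) := by
  have hid2 : ∀ j, IdentDistrib (fun ω => Y j ω ^ 2) (fun ω => Z ω ^ 2) μ μ := fun j =>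
    (hid j).comp (u := fun x => x ^ 2) (by fun_prop)
  have hind2 : iIndepFun (fun j ω => Y j ω ^ 2) μ :=
    hind.comp (fun _ x => x ^ 2) fun _ => by fun_prop
  have hY2 : ∀ j, Measurable (fun ω => Y j ω ^ 2) := fun j => (hY j).pow_const 2
  have hint : Integrable (fun ω => Real.exp (-t * Z ω ^ 2)) μ := by
    refine (integrable_const (1 : ℝ)).mono' (by fun_prop) (ae_of_all _ fun ω => ?_)
    rw [Real.norm_eq_abs, Real.abs_exp, Real.exp_le_one_iff]
    nlinarith [sq_nonneg (Z ω)]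
  have h := measure_le_le_exp_mul_mgf (μ := μ) (X := fun ω => ∑ j ∈ Finset.range n, Y j ω ^ 2)
    (v / 2 * n) (by linarith : -t ≤ 0) (integrable_exp_mul_sum_range hY2 hind2 hid2 hint n)
  rw [mgf_sum_range_eq_pow hY2 hind2 hid2] at h
  rw [← ofReal_measureReal]
  refine ENNReal.ofReal_le_ofReal (h.trans ?_)
  calc Real.exp (- -t * (v / 2 * n)) * mgf (fun ω => Z ω ^ 2) μ (-t) ^ n
      ≤ Real.exp (- -t * (v / 2 * n)) * Real.exp (-(t * (v / 2)) - a) ^ n := by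
        gcongr
        exact mgf_nonneg
    _ = Real.exp (-(a * n)) := by
        rw [← Real.exp_nat_mul, ← Real.exp_add]
        congr 1
        ring

end Maximal

/-! ### Sample statistics -/

/-- The admissible sample sizes, whose minimum is `sampleSize`. -/
def sampleSizeSet (κ lam Δ : ℝ) (y : ℕ → ℝ) : Set ℕ :=
  {n : ℕ | 2 ≤ n ∧ lam ≤ n ∧
    Real.sqrt (sampleVar y n) / Real.sqrt n ≤ κ * Δ ^ 2 / Real.sqrt lam}

lemma sampleSize_mem {κ lam Δ : ℝ} {y : ℕ → ℝ} (h : (sampleSizeSet κ lam Δ y).Nonempty) :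
    sampleSize κ lam Δ y ∈ sampleSizeSet κ lam Δ y := Nat.sInf_mem h

lemma sampleMean_const_add (a : ℝ) (y : ℕ → ℝ) {n : ℕ} (hn : n ≠ 0) :
    sampleMean (fun j => a + y j) n = a + sampleMean y n := by
  have : (n : ℝ) ≠ 0 := by exact_mod_cast hn
  simp only [sampleMean, Finset.sum_add_distrib, Finset.sum_const, Finset.card_range, nsmul_eq_mul]
  field_simp

lemma sampleVar_const_add (a : ℝ) (y : ℕ → ℝ) {n : ℕ} (hn : n ≠ 0) :
    sampleVar (fun j => a + y j) n = sampleVar y n := by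
  simp only [sampleVar, sampleMean_const_add a y hn, add_sub_add_left_eq_sub]

lemma sampleSizeSet_const_add (κ lam Δ a : ℝ) (y : ℕ → ℝ) :
    sampleSizeSet κ lam Δ (fun j => a + y j) = sampleSizeSet κ lam Δ y := by
  ext n
  simp only [sampleSizeSet, Set.mem_ofPred_eq]
  refine and_congr_right fun hn => ?_
  rw [sampleVar_const_add a y (by omega)]

/-- Passes from oracle outputs to errors: the sample variance ignores shifts, so the same sample
size is chosen. Nonemptiness excludes the default size 0, at which the mean is 0 and does not shift.
-/
lemma estimate_const_add {κ lam Δ : ℝ} (a : ℝ) {y : ℕ → ℝ}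
    (h : (sampleSizeSet κ lam Δ y).Nonempty) :
    estimate κ lam Δ (fun j => a + y j) = a + estimate κ lam Δ y := by
  have h1 : sampleSize κ lam Δ (fun j => a + y j) = sampleSize κ lam Δ y :=
    congrArg sInf (sampleSizeSet_const_add κ lam Δ a y)
  have h2 := (sampleSize_mem h).1
  rw [estimate, estimate, h1, sampleMean_const_add a y (by omega)]

lemma sampleVar_eq (y : ℕ → ℝ) {n : ℕ} (hn : n ≠ 0) :
    sampleVar y n = (∑ j ∈ Finset.range n, y j ^ 2 - n * sampleMean y n ^ 2) / ((n : ℝ) - 1) := by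
  have h0 : (n : ℝ) ≠ 0 := by exact_mod_cast hn
  have h1 : ∑ j ∈ Finset.range n, y j = n * sampleMean y n := by
    rw [sampleMean]; field_simp
  rw [sampleVar]
  congr 1
  calc ∑ j ∈ Finset.range n, (y j - sampleMean y n) ^ 2
      = ∑ j ∈ Finset.range n, (y j ^ 2 - 2 * sampleMean y n * y j + sampleMean y n ^ 2) :=
        Finset.sum_congr rfl fun j _ => by ring
    _ = ∑ j ∈ Finset.range n, y j ^ 2 - n * sampleMean y n ^ 2 := by
        rw [Finset.sum_add_distrib, Finset.sum_sub_distrib, ← Finset.mul_sum, h1]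
        simp only [Finset.sum_const, Finset.card_range, nsmul_eq_mul]
        ring

/-- The sampling rule stops if the averages of the squares converge. -/
lemma sampleSizeSet_nonempty {κ lam Δ C : ℝ} (hκ : 0 < κ) (hlam : 0 < lam) (hΔ : 0 < Δ) {y : ℕ → ℝ}
    (hy : Tendsto (fun n : ℕ => (∑ j ∈ Finset.range n, y j ^ 2) / n) atTop (nhds C)) :
    (sampleSizeSet κ lam Δ y).Nonempty := by
  have hbdd : ∀ᶠ n : ℕ in atTop, (∑ j ∈ Finset.range n, y j ^ 2) / n < C + 1 :=
    hy.eventually_lt_const (by linarith)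
  have hrhs : 0 < κ * Δ ^ 2 / Real.sqrt lam := by positivity
  -- Once the averages of squares are below `C + 1`, the sample variance is at most `2 (C + 1)`, as
  -- `n / (n - 1) ≤ 2`.
  have hlim : Tendsto (fun n : ℕ => Real.sqrt (2 * (C + 1)) / Real.sqrt n) atTop (nhds 0) :=
    (Real.tendsto_sqrt_atTop.comp tendsto_natCast_atTop_atTop).const_div_atTop _
  have hsmall := hlim.eventually_lt_const hrhs
  obtain ⟨n, h1, h2, h3, h4⟩ := (hbdd.and (hsmall.and ((eventually_ge_atTop 2).and
    (tendsto_natCast_atTop_atTop.eventually_ge_atTop lam)))).exists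
  refine ⟨n, h3, h4, le_trans ?_ h2.le⟩
  have hn : (2 : ℝ) ≤ n := by exact_mod_cast h3
  gcongr
  rw [sampleVar_eq y (by omega), div_le_iff₀ (by linarith)]
  rw [div_lt_iff₀ (by linarith)] at h1
  have h5 : 0 ≤ (n : ℝ) * sampleMean y n ^ 2 := by positivity
  have h6 : 0 ≤ ∑ j ∈ Finset.range n, y j ^ 2 := by positivity
  have h7 : 0 < (C + 1) := pos_of_mul_pos_left (lt_of_le_of_lt h6 h1) (by linarith)
  nlinarith

/-- The estimate is as accurate as `c Δ²` when the squares and the sums obey the bounds that hold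
outside of small events. -/
lemma abs_estimate_le {κ lam Δ c v β d : ℝ} (hlam : 0 < lam) (hc : 0 < c)
    (hv : 0 < v) (hβ : 0 < β) (hd : 0 ≤ d) (hdΔ : d ≤ Δ ^ 4)
    (hβc : 4 * β * (4 * κ ^ 2 / v + 1) ≤ c ^ 2) (hβv : 4 * β * (1 + d) ≤ v / 4)
    {y : ℕ → ℝ} (hne : (sampleSizeSet κ lam Δ y).Nonempty)
    (hsq : ∀ n : ℕ, lam ≤ n → v / 2 * n < ∑ j ∈ Finset.range n, y j ^ 2)
    (hsum : ∀ m n : ℕ, lam ≤ (2 : ℝ) ^ m → 1 ≤ n → n ≤ 2 ^ m →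
      |∑ j ∈ Finset.range n, y j| ≤ Real.sqrt (β * (lam / 2 ^ m + d)) * 2 ^ m) :
    |estimate κ lam Δ y| ≤ c * Δ ^ 2 := by
  obtain ⟨hn2, hnlam, hsize⟩ := sampleSize_mem hne
  rw [estimate]
  set n := sampleSize κ lam Δ y with hn
  have hn0 : (2 : ℝ) ≤ n := by exact_mod_cast hn2
  have hnpos : (0 : ℝ) < n := by linarith
  -- Rounding `n` up to a power of two costs a factor of at most 2 in the mean.
  obtain ⟨m, hnm, hmn⟩ : ∃ m : ℕ, n ≤ 2 ^ m ∧ 2 ^ m ≤ 2 * n := by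
    refine ⟨Nat.clog 2 n, Nat.le_pow_clog (by norm_num) n, ?_⟩
    have h1 := Nat.pow_pred_clog_lt_self (b := 2) (by norm_num) (x := n) (by omega)
    have h2 : 0 < Nat.clog 2 n := Nat.clog_pos (by norm_num) (by omega)
    have h3 : 2 ^ Nat.clog 2 n = 2 * 2 ^ (Nat.clog 2 n).pred := by
      rw [← pow_succ']
      congr 1
      exact (Nat.succ_pred_eq_of_pos h2).symm
    omega
  have hnm' : (n : ℝ) ≤ 2 ^ m := by exact_mod_cast hnm
  have hmn' : (2 : ℝ) ^ m ≤ 2 * n := by exact_mod_cast hmn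
  have hw0 : 0 ≤ lam / n + d := by positivity
  have hmean : |sampleMean y n| ≤ 2 * Real.sqrt (β * (lam / n + d)) := by
    rw [sampleMean, abs_div, abs_of_pos hnpos, div_le_iff₀ hnpos]
    calc |∑ j ∈ Finset.range n, y j|
        ≤ Real.sqrt (β * (lam / 2 ^ m + d)) * 2 ^ m :=
          hsum m n (hnlam.trans hnm') (by omega) hnm
      _ ≤ Real.sqrt (β * (lam / n + d)) * (2 * n) := by gcongr
      _ = _ := by ring
  have hmean2 : sampleMean y n ^ 2 ≤ 4 * β * (lam / n + d) := by
    rw [← sq_abs]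
    calc |sampleMean y n| ^ 2 ≤ (2 * Real.sqrt (β * (lam / n + d))) ^ 2 := by gcongr
      _ = _ := by rw [mul_pow, Real.sq_sqrt (by positivity)]; ring
  have hlamn : lam / n ≤ 1 := (div_le_one hnpos).2 hnlam
  have hvar : v / 4 ≤ sampleVar y n := by
    rw [sampleVar_eq y (by omega), le_div_iff₀ (by linarith)]
    have h1 := hsq n hnlam
    have h2 : sampleMean y n ^ 2 ≤ v / 4 := hmean2.trans (le_trans (by gcongr) hβv)
    nlinarith
  -- The stopping rule read backwards: `sampleVar · lam ≤ κ² Δ⁴ n`, with the sample variance at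
  -- least `v / 4`.
  have hlamΔ : lam / n ≤ 4 * κ ^ 2 / v * Δ ^ 4 := by
    rw [div_le_div_iff₀ (by positivity) (by positivity)] at hsize
    have h1 : (Real.sqrt (sampleVar y n) * Real.sqrt lam) ^ 2 ≤ (κ * Δ ^ 2 * Real.sqrt n) ^ 2 := by
      gcongr
    rw [mul_pow, mul_pow, Real.sq_sqrt (by linarith), Real.sq_sqrt hlam.le,
      Real.sq_sqrt hnpos.le] at h1
    rw [div_le_iff₀ hnpos, div_mul_eq_mul_div, div_mul_eq_mul_div, le_div_iff₀ hv]
    have h2 : v / 4 * lam ≤ sampleVar y n * lam := by gcongr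
    nlinarith
  refine abs_le_of_sq_le_sq ?_ (by positivity)
  calc sampleMean y n ^ 2 ≤ 4 * β * (lam / n + d) := hmean2
    _ ≤ 4 * β * (4 * κ ^ 2 / v * Δ ^ 4 + Δ ^ 4) := by gcongr
    _ = 4 * β * (4 * κ ^ 2 / v + 1) * Δ ^ 4 := by ring
    _ ≤ c ^ 2 * Δ ^ 4 := by gcongr
    _ = (c * Δ ^ 2) ^ 2 := by ring

/-! ### Summability and the Borel–Cantelli lemma -/

/-- The extra factor `(log k)^ε` tends to infinity and beats every constant; hence `exp (-a λ_k)` is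
eventually below any power of `1/k`. -/
lemma LambdaAssumption.eventually_mul_log_le {lam : ℕ → ℝ} (h : LambdaAssumption lam)
    (hpos : ∀ k, 0 < lam k) (A : ℝ) : ∀ᶠ k : ℕ in atTop, A * Real.log k ≤ lam k := by
  obtain ⟨ε, ⟨hε, -⟩, hO⟩ := h
  obtain ⟨C, hC, hbound⟩ := hO.exists_pos
  have hlog : Tendsto (fun k : ℕ => Real.log k) atTop atTop :=
    Real.tendsto_log_atTop.comp tendsto_natCast_atTop_atTop
  have hpow : Tendsto (fun k : ℕ => Real.log k ^ ε) atTop atTop :=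
    (tendsto_rpow_atTop hε).comp hlog
  filter_upwards [hbound.bound, hlog.eventually_ge_atTop 1,
    hpow.eventually_ge_atTop (A * C)] with k h1 h2 h3
  rw [Real.norm_eq_abs, Real.norm_eq_abs, abs_of_pos (hpos k), abs_of_nonneg (by positivity),
    Real.rpow_add (by linarith), Real.rpow_one] at h1
  have h4 : Real.log k * (A * C) ≤ C * lam k := le_trans (by gcongr) h1
  nlinarith

lemma summable_mul_exp_neg {lam : ℕ → ℝ} (h : ∀ A : ℝ, ∀ᶠ k : ℕ in atTop, A * Real.log k ≤ lam k)
    {a : ℝ} (ha : 0 < a) {B C : ℝ} (hB : 0 ≤ B) (hC : 0 ≤ C) :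
    Summable fun k : ℕ => (B * k + C) * Real.exp (-(a * lam k)) := by
  have hs : Summable fun k : ℕ => (B + C) * ((k : ℝ) ^ 2)⁻¹ :=
    (Real.summable_nat_pow_inv.2 (by norm_num)).mul_left _
  refine summable_of_isBigO_nat hs (IsBigO.of_bound 1 ?_)
  filter_upwards [h (3 / a), eventually_ge_atTop 1] with k h1 h2
  have hk : (1 : ℝ) ≤ k := by exact_mod_cast h2
  have hk0 : (0 : ℝ) < k := by linarith
  rw [Real.norm_eq_abs, Real.norm_eq_abs, abs_of_nonneg (by positivity),
    abs_of_nonneg (by positivity), one_mul]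
  have h3 : Real.exp (-(a * lam k)) ≤ ((k : ℝ) ^ 3)⁻¹ := by
    rw [← Real.exp_log (by positivity : 0 < ((k : ℝ) ^ 3)⁻¹), Real.exp_le_exp, Real.log_inv,
      Real.log_pow, neg_le_neg_iff]
    rw [div_mul_eq_mul_div, div_le_iff₀ ha] at h1
    push_cast
    linarith
  calc (B * k + C) * Real.exp (-(a * lam k)) ≤ (B * k + C * k) * ((k : ℝ) ^ 3)⁻¹ := by
        gcongr
        nlinarith
    _ = (B + C) * ((k : ℝ) ^ 2)⁻¹ := by field_simp

lemma summable_exp_neg_mul_two_pow {x : ℝ} (hx : 0 < x) :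
    Summable fun m : ℕ => Real.exp (-(x * 2 ^ m)) := by
  refine Summable.of_nonneg_of_le (fun m => (Real.exp_pos _).le) (fun m => ?_)
    (Real.summable_exp_nat_mul_iff.2 (neg_neg_of_pos hx))
  rw [Real.exp_le_exp]
  have : (m : ℝ) ≤ 2 ^ m := by exact_mod_cast Nat.lt_two_pow_self.le
  nlinarith

/-- With `2^L q > 1`, the first `L k` terms are at most 1 each; beyond them `q^k 2^(m + L k) ≥ 2^m`,
so the tail is bounded independently of `k`. -/
lemma exists_tsum_exp_neg_mul_two_pow_le {x q : ℝ} (hx : 0 < x) (hq : 0 < q) :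
    ∃ B C : ℝ, 0 ≤ B ∧ 0 ≤ C ∧ ∀ k : ℕ, ∑' m : ℕ, Real.exp (-(x * q ^ k * 2 ^ m)) ≤ B * k + C := by
  obtain ⟨L, hL⟩ : ∃ L : ℕ, 1 / q < 2 ^ L := pow_unbounded_of_one_lt _ (by norm_num)
  rw [div_lt_iff₀ hq] at hL
  refine ⟨L, ∑' m : ℕ, Real.exp (-(x * 2 ^ m)), by positivity,
    tsum_nonneg fun m => (Real.exp_pos _).le, fun k => ?_⟩
  have hs := summable_exp_neg_mul_two_pow (x := x * q ^ k) (by positivity)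
  rw [← hs.sum_add_tsum_nat_add (L * k)]
  gcongr ?_ + ?_
  · calc ∑ m ∈ Finset.range (L * k), Real.exp (-(x * q ^ k * 2 ^ m))
        ≤ ∑ m ∈ Finset.range (L * k), (1 : ℝ) := Finset.sum_le_sum fun m _ =>
          Real.exp_le_one_iff.2 (by simp only [Left.neg_nonpos_iff]; positivity)
      _ = L * k := by simp
  · refine Summable.tsum_le_tsum (fun m => ?_) ((summable_nat_add_iff (L * k)).2 hs)
      (summable_exp_neg_mul_two_pow hx)
    rw [Real.exp_le_exp, neg_le_neg_iff]
    have h1 : (1 : ℝ) ≤ (2 ^ L * q) ^ k := one_le_pow₀ hL.le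
    calc x * 2 ^ m ≤ x * 2 ^ m * (2 ^ L * q) ^ k := le_mul_of_one_le_right (by positivity) h1
      _ = x * q ^ k * 2 ^ (m + L * k) := by rw [mul_pow, pow_add, pow_mul]; ring

lemma summable_exp_neg_mul_exp_neg_two_pow {lam : ℕ → ℝ}
    (h : ∀ A : ℝ, ∀ᶠ k : ℕ in atTop, A * Real.log k ≤ lam k) {a x q : ℝ} (ha : 0 < a)
    (hx : 0 < x) (hq : 0 < q) :
    Summable fun p : ℕ × ℕ => Real.exp (-(a * lam p.1)) * Real.exp (-(x * q ^ p.1 * 2 ^ p.2)) := by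
  obtain ⟨B, C, hB, hC, hBC⟩ := exists_tsum_exp_neg_mul_two_pow_le hx hq
  refine (summable_prod_of_nonneg fun p => by positivity).2 ⟨fun k => ?_, ?_⟩
  · exact (summable_exp_neg_mul_two_pow (x := x * q ^ k) (by positivity)).mul_left (Real.exp (-(a * lam k)))
  · refine Summable.of_nonneg_of_le (fun k => tsum_nonneg fun m => by positivity) (fun k => ?_)
      (summable_mul_exp_neg h ha hB hC)
    simp only [tsum_mul_left]
    rw [mul_comm (B * (k : ℝ) + C)]
    gcongr
    exact hBC k

/-- Borel–Cantelli over pairs: only finitely many events occur, so beyond their largest first index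
none occurs for any `m`. -/
lemma ae_eventually_forall_notMem {Ω : Type*} [MeasurableSpace Ω] {μ : Measure Ω}
    {s : ℕ → ℕ → Set Ω} {f : ℕ × ℕ → ℝ} (hs : ∀ k m, μ (s k m) ≤ ENNReal.ofReal (f (k, m)))
    (hf : Summable f) : ∀ᵐ ω ∂μ, ∀ᶠ k in atTop, ∀ m, ω ∉ s k m := by
  have h1 : ∑' p : ℕ × ℕ, μ (s p.1 p.2) ≠ ⊤ :=
    ne_top_of_le_ne_top hf.tsum_ofReal_ne_top (ENNReal.tsum_le_tsum fun p => hs p.1 p.2)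
  filter_upwards [ae_finite_setOfPred_mem h1] with ω hω
  obtain ⟨K, hK⟩ := (hω.image Prod.fst).bddAbove
  filter_upwards [eventually_gt_atTop K] with k hk m hm
  exact absurd (hK ⟨(k, m), hm, rfl⟩) (not_le.2 hk)

/-! ### Accuracy of the adaptive estimates -/

section Accuracy

variable {Ω : Type*} [MeasurableSpace Ω] {μ : Measure Ω} {Z : Ω → ℝ}
  {Y : ℕ → ℕ → Ω → ℝ}

/-- The strong law for the squares. The null set does not depend on `κ`, `lam`, `Δ`, so a random
radius may be inserted. -/
lemma ae_sampleSizeSet_nonempty (hind : ∀ k, iIndepFun (Y k) μ)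
    (hid : ∀ k j, IdentDistrib (Y k j) Z μ μ) (hZ2 : Integrable (fun ω => Z ω ^ 2) μ) :
    ∀ᵐ ω ∂μ, ∀ k, ∀ κ lam Δ : ℝ, 0 < κ → 0 < lam → 0 < Δ →
      (sampleSizeSet κ lam Δ (fun j => Y k j ω)).Nonempty := by
  rw [ae_all_iff]
  intro k
  have hid2 : ∀ j, IdentDistrib (fun ω => Y k j ω ^ 2) (fun ω => Z ω ^ 2) μ μ := fun j =>
    (hid k j).comp (u := fun x => x ^ 2) (by fun_prop)
  have hind2 : iIndepFun (fun j ω => Y k j ω ^ 2) μ :=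
    (hind k).comp (fun _ x => x ^ 2) fun _ => by fun_prop
  filter_upwards [strong_law_ae_real (fun j ω => Y k j ω ^ 2) ((hid2 0).integrable_iff.2 hZ2)
    (fun i j hij => hind2.indepFun hij) fun j => (hid2 j).trans (hid2 0).symm] with ω hω
  exact fun κ lam Δ hκ hlam hΔ => sampleSizeSet_nonempty hκ hlam hΔ hω

/-- Eventually all sums of squares of at least `lam k` variables are large. -/
lemma ae_eventually_sum_sq_gt [IsProbabilityMeasure μ] (hY : ∀ k j, Measurable (Y k j)) (hind : ∀ k, iIndepFun (Y k) μ)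
    (hid : ∀ k j, IdentDistrib (Y k j) Z μ μ) (hZ : Measurable Z) {s₁ v : ℝ} (hs₁ : 0 < s₁)
    (hexp : Integrable (fun ω => Real.exp (s₁ * |Z ω|)) μ) (hv : ∫ ω, Z ω ^ 2 ∂μ = v)
    (hv0 : 0 < v) {lam : ℕ → ℝ} (hlam : ∀ A : ℝ, ∀ᶠ k : ℕ in atTop, A * Real.log k ≤ lam k) :
    ∀ᵐ ω ∂μ, ∀ᶠ k in atTop, ∀ n : ℕ, lam k ≤ n →
      v / 2 * n < ∑ j ∈ Finset.range n, Y k j ω ^ 2 := by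
  obtain ⟨t, a, ht, ha, hmgf⟩ := exists_mgf_neg_sq_le hs₁ hZ hexp hv hv0
  -- Since `lam k ≤ n`, the exponent `a n` splits into `a/2 · lam k + a/2 · n`, one half for each
  -- summation.
  have hf : Summable fun p : ℕ × ℕ =>
      Real.exp (-(a / 2 * lam p.1)) * Real.exp (p.2 * -(a / 2)) := by
    have h1 : Summable fun k => Real.exp (-(a / 2 * lam k)) := by
      simpa using summable_mul_exp_neg hlam (half_pos ha) le_rfl zero_le_one
    exact h1.mul_of_nonneg (Real.summable_exp_nat_mul_iff.2 (by linarith))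
      (fun k => (Real.exp_pos _).le) fun n => (Real.exp_pos _).le
  have hs : ∀ k n : ℕ, μ {ω | lam k ≤ n ∧ ∑ j ∈ Finset.range n, Y k j ω ^ 2 ≤ v / 2 * n} ≤
      ENNReal.ofReal (Real.exp (-(a / 2 * lam k)) * Real.exp (n * -(a / 2))) := by
    intro k n
    by_cases hn : lam k ≤ n
    · simp only [hn, true_and]
      refine (measure_sum_sq_le_le (hY k) (hind k) (hid k) hZ ht hmgf n).trans
        (ENNReal.ofReal_le_ofReal ?_)
      rw [← Real.exp_add, Real.exp_le_exp]
      nlinarith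
    · simp [hn]
  filter_upwards [ae_eventually_forall_notMem hs hf] with ω hω
  filter_upwards [hω] with k hk n hn
  by_contra hcon
  exact hk n ⟨hn, not_lt.1 hcon⟩

/-- Eventually all partial sums are bounded, uniformly over dyadic blocks. -/
lemma ae_eventually_abs_sum_le [IsProbabilityMeasure μ] (hY : ∀ k j, Measurable (Y k j)) (hind : ∀ k, iIndepFun (Y k) μ)
    (hid : ∀ k j, IdentDistrib (Y k j) Z μ μ) (hZ : Integrable Z μ) (hmean : ∫ ω, Z ω ∂μ = 0)
    {s V : ℝ} (hs : 0 ≤ s) (hV : 0 < V) (hmgf : ∀ t : ℝ, |t| ≤ s →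
      Integrable (fun ω => Real.exp (t * Z ω)) μ ∧ mgf Z μ t ≤ Real.exp (V * t ^ 2))
    {lam : ℕ → ℝ} (hlam : ∀ A : ℝ, ∀ᶠ k : ℕ in atTop, A * Real.log k ≤ lam k)
    (hpos : ∀ k, 0 < lam k) {D q β : ℝ} (hD : 0 < D) (hq : 0 < q) (hq1 : q ≤ 1) (hβ : 0 < β)
    (hβs : β * (1 + D) ≤ (2 * V * s) ^ 2) :
    ∀ᵐ ω ∂μ, ∀ᶠ k in atTop, ∀ m n : ℕ, lam k ≤ (2 : ℝ) ^ m → 1 ≤ n → n ≤ 2 ^ m →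
      |∑ j ∈ Finset.range n, Y k j ω| ≤
        Real.sqrt (β * (lam k / 2 ^ m + D * q ^ k)) * 2 ^ m := by
  set a := β / (4 * V) with ha
  have ha0 : 0 < a := by positivity
  have hf := (summable_exp_neg_mul_exp_neg_two_pow hlam ha0 (mul_pos ha0 hD) hq).mul_left 2
  -- The maximal inequality counts `n + 1` summands with `n ≤ M`, hence `M = 2^m - 1`. In the
  -- exponent, `lam k / 2^m` contributes `a * lam k`, constant in `m`; the term `D * q ^ k` supplies
  -- the decay in `m`.
  have hbad : ∀ k m, μ {ω | lam k ≤ (2 : ℝ) ^ m ∧ ∃ n ≤ 2 ^ m - 1,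
      Real.sqrt (β * (lam k / 2 ^ m + D * q ^ k)) * (((2 ^ m - 1 : ℕ) : ℝ) + 1) ≤
        |∑ j ∈ Finset.range (n + 1), Y k j ω|} ≤
      ENNReal.ofReal (2 * (Real.exp (-(a * lam k)) * Real.exp (-(a * D * q ^ k * 2 ^ m)))) := by
    intro k m
    by_cases hm : lam k ≤ (2 : ℝ) ^ m
    · simp only [hm, true_and]
      have hl := hpos k
      have hw : 0 ≤ β * (lam k / 2 ^ m + D * q ^ k) := by positivity
      refine (measure_exists_abs_sum_ge_le (hY k) (hind k) (hid k) hZ hmean hV hmgf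
        (Real.sqrt_nonneg _) ?_ _).trans (le_of_eq ?_)
      · rw [Real.sqrt_le_left (by positivity)]
        refine le_trans ?_ hβs
        have h1 : lam k / 2 ^ m ≤ 1 := (div_le_one (by positivity)).2 hm
        have h2 : q ^ k ≤ 1 := pow_le_one₀ hq.le hq1
        gcongr
        nlinarith
      · have h3 : (((2 ^ m - 1 : ℕ) : ℝ) + 1) = 2 ^ m := by
          rw [Nat.cast_sub Nat.one_le_two_pow]
          push_cast
          ring
        rw [ENNReal.ofReal_mul (by norm_num), ← Real.exp_add, Real.sq_sqrt hw, h3]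
        congr 3
        · simp
        · rw [ha]
          field_simp
          ring
    · simp [hm]
  filter_upwards [ae_eventually_forall_notMem hbad hf] with ω hω
  filter_upwards [hω] with k hk m n hm hn1 hnm
  by_contra hcon
  refine hk m ⟨hm, n - 1, by omega, ?_⟩
  have h3 : (((2 ^ m - 1 : ℕ) : ℝ) + 1) = 2 ^ m := by
    rw [Nat.cast_sub Nat.one_le_two_pow]
    push_cast
    ring
  rw [h3, Nat.sub_add_cancel hn1]
  exact (not_le.1 hcon).le

/-- Eventually all adaptive estimates of zero are of the order of the squared radius, uniformly over
all radii that decay at most geometrically. -/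
theorem ae_eventually_abs_estimate_le [IsProbabilityMeasure μ] (hY : ∀ k j, Measurable (Y k j))
    (hind : ∀ k, iIndepFun (Y k) μ) (hid : ∀ k j, IdentDistrib (Y k j) Z μ μ) (hZ : Measurable Z)
    {s₁ : ℝ} (hs₁ : 0 < s₁) (hexp : Integrable (fun ω => Real.exp (s₁ * |Z ω|)) μ)
    (hmean : ∫ ω, Z ω ∂μ = 0) {lam : ℕ → ℝ} (hpos : ∀ k, 0 < lam k)
    (hlam : ∀ A : ℝ, ∀ᶠ k : ℕ in atTop, A * Real.log k ≤ lam k) {κ c D q : ℝ} (hκ : 0 < κ)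
    (hc : 0 < c) (hD : 0 < D) (hq : 0 < q) (hq1 : q ≤ 1) :
    ∀ᵐ ω ∂μ, ∀ᶠ k in atTop, ∀ Δ : ℝ, D * q ^ k ≤ Δ →
      |estimate κ (lam k) Δ (fun j => Y k j ω)| ≤ c * Δ ^ 2 := by
  have hintpow : ∀ m, Integrable (fun ω => |Z ω| ^ m) μ := fun m => by
    simpa using integrable_pow_mul_exp_abs hZ hexp hs₁ m
  have hint2 : Integrable (fun ω => Z ω ^ 2) μ := by simpa using hintpow 2
  have hint1 : Integrable Z μ := by
    have := hintpow 1
    simp only [pow_one] at this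
    exact this.mono' (by fun_prop) (ae_of_all _ fun ω => le_rfl)
  set v := ∫ ω, Z ω ^ 2 ∂μ with hv
  have hv0 : 0 ≤ v := integral_nonneg fun ω => sq_nonneg _
  rcases hv0.eq_or_lt with hv0 | hv0
  -- Degenerate errors vanish almost surely, so the estimate is 0 whatever the sample size.
  · have hzero : ∀ k j, ∀ᵐ ω ∂μ, Y k j ω = 0 := by
      intro k j
      have hid2 : IdentDistrib (fun ω => Y k j ω ^ 2) (fun ω => Z ω ^ 2) μ μ :=
        (hid k j).comp (u := fun x => x ^ 2) (by fun_prop)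
      have h1 : ∫ ω, Y k j ω ^ 2 ∂μ = 0 := by rw [hid2.integral_eq, ← hv, ← hv0]
      rw [integral_eq_zero_iff_of_nonneg (fun ω => sq_nonneg _) (hid2.integrable_iff.2 hint2)] at h1
      filter_upwards [h1] with ω hω
      exact pow_eq_zero_iff (two_ne_zero) |>.1 hω
    filter_upwards [ae_all_iff.2 fun k => ae_all_iff.2 fun j => hzero k j] with ω hω
    refine Eventually.of_forall fun k Δ _ => ?_
    simp only [hω, estimate, sampleMean, Finset.sum_const_zero, zero_div, abs_zero]
    positivity
  · obtain ⟨s, V, hs, hV, hmgf⟩ := exists_mgf_le_exp_sq hs₁ hZ hexp hmean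
    -- The three conditions give the accuracy `c`, the lower bound `v / 4` on the sample variance,
    -- and deviations within the Gaussian range.
    obtain ⟨β, hβ, h1, h2, h3⟩ : ∃ β : ℝ, 0 < β ∧ 4 * β * (4 * κ ^ 2 / v + 1) ≤ c ^ 2 ∧
        4 * β * (1 + D ^ 4) ≤ v / 4 ∧ β * (1 + D ^ 4) ≤ (2 * V * s) ^ 2 := by
      refine ⟨min (c ^ 2 / (4 * (4 * κ ^ 2 / v + 1))) (min (v / 4 / (4 * (1 + D ^ 4)))
        ((2 * V * s) ^ 2 / (1 + D ^ 4))), by positivity, ?_, ?_, ?_⟩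
      · rw [mul_right_comm, mul_comm, ← le_div_iff₀ (by positivity)]
        exact min_le_left _ _
      · rw [mul_right_comm, mul_comm, ← le_div_iff₀ (by positivity)]
        exact (min_le_right _ _).trans (min_le_left _ _)
      · rw [← le_div_iff₀ (by positivity)]
        exact (min_le_right _ _).trans (min_le_right _ _)
    filter_upwards [ae_sampleSizeSet_nonempty hind hid hint2,
      ae_eventually_sum_sq_gt hY hind hid hZ hs₁ hexp hv.symm hv0 hlam,
      ae_eventually_abs_sum_le hY hind hid hint1 hmean hs.le hV hmgf hlam hpos (by positivity)
        (by positivity : 0 < q ^ 4) (pow_le_one₀ hq.le hq1) hβ h3] with ω hne hsq hsum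
    filter_upwards [hsq, hsum] with k hksq hksum Δ hΔ
    have hΔ0 : 0 < Δ := lt_of_lt_of_le (by positivity) hΔ
    have hd : D ^ 4 * (q ^ 4) ^ k = (D * q ^ k) ^ 4 := by rw [mul_pow, pow_right_comm]
    refine abs_estimate_le (hpos k) hc hv0 hβ (by positivity) ?_ h1 (le_trans ?_ h2)
      (hne k κ (lam k) Δ hκ (hpos k) hΔ0) hksq hksum
    · rw [hd]
      gcongr
    · gcongr
      exact mul_le_of_le_one_right (by positivity) (pow_le_one₀ (by positivity)
        (pow_le_one₀ hq.le hq1))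

end Accuracy

/-! ### Accuracy of the model -/

section Model

variable {d : ℕ} {f : E d → ℝ}

/-- First-order Taylor bound on a ball where the gradient is Lipschitz. -/
lemma abs_sub_inner_gradient_le {U : Set (E d)} {L : NNReal} (hU : IsOpen U)
    (hf : DifferentiableOn ℝ f U) (hL : LipschitzOnWith L (gradient f) U) {x s : E d} {Δ : ℝ}
    (hball : Metric.closedBall x Δ ⊆ U) (hs : ‖s‖ ≤ Δ) :
    |f (x + s) - f x - inner ℝ s (gradient f x)| ≤ L * Δ ^ 2 := by
  have hΔ : 0 ≤ Δ := (norm_nonneg s).trans hs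
  have hx : x ∈ Metric.closedBall x Δ := Metric.mem_closedBall_self hΔ
  have hxs : x + s ∈ Metric.closedBall x Δ := by simpa using hs
  have hderiv : ∀ y ∈ Metric.closedBall x Δ,
      HasFDerivWithinAt f (InnerProductSpace.toDual ℝ (E d) (gradient f y))
        (Metric.closedBall x Δ) y := fun y hy =>
    (hf.differentiableAt (hU.mem_nhds (hball hy))).hasGradientAt.hasFDerivAt.hasFDerivWithinAt
  have hbound : ∀ y ∈ Metric.closedBall x Δ, ‖InnerProductSpace.toDual ℝ (E d) (gradient f y) -
      InnerProductSpace.toDual ℝ (E d) (gradient f x)‖ ≤ L * Δ := by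
    intro y hy
    rw [← map_sub, LinearIsometryEquiv.norm_map]
    refine (hL.norm_sub_le (hball hy) (hball hx)).trans ?_
    gcongr
    exact mem_closedBall_iff_norm.1 hy
  have h := (convex_closedBall x Δ).norm_image_sub_le_of_norm_hasFDerivWithin_le' hderiv hbound
    hx hxs
  rw [add_sub_cancel_left, InnerProductSpace.toDual_apply_apply, real_inner_comm,
    Real.norm_eq_abs] at h
  calc _ ≤ L * Δ * ‖s‖ := h
    _ ≤ L * Δ * Δ := by gcongr
    _ = L * Δ ^ 2 := by ring

lemma norm_le_card_mul {x : E d} {B : ℝ} (h : ∀ i, |x i| ≤ B) : ‖x‖ ≤ d * B := by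
  calc ‖x‖ = ‖∑ i, EuclideanSpace.single i (x i)‖ := by
        congr 1
        ext j
        simp [Finset.sum_apply, Pi.single_apply]
    _ ≤ ∑ i, ‖EuclideanSpace.single i (x i)‖ := norm_sum_le _ _
    _ ≤ ∑ _i : Fin d, B := Finset.sum_le_sum fun i _ => by simpa using h i
    _ = d * B := by simp

lemma quadModel_zero (β₀ : ℝ) (g : E d) (h : Fin d → ℝ) : quadModel β₀ g h 0 = β₀ := by
  simp [quadModel]

lemma DesignIdx.norm_dir_le (i : DesignIdx d) : ‖i.dir‖ ≤ 1 := by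
  cases i <;> simp [DesignIdx.dir]

variable {x : E d} {Δ L : ℝ} {β₀ : ℝ} {g : E d} {h : Fin d → ℝ} {Fb : DesignIdx d → ℝ}

/-- The gradient of an interpolation model is accurate. -/
lemma norm_modelGradient_sub_le (hΔ : 0 < Δ)
    (htaylor : ∀ s : E d, ‖s‖ ≤ Δ → |f (x + s) - f x - inner ℝ s (gradient f x)| ≤ L * Δ ^ 2)
    (hint : ∀ i : DesignIdx d, quadModel β₀ g h (Δ • i.dir) = Fb i)
    (hFb : ∀ i : DesignIdx d, |Fb i - f (x + Δ • i.dir)| ≤ Δ ^ 2) :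
    ‖g - gradient f x‖ ≤ d * ((L + 1) * Δ) := by
  refine norm_le_card_mul fun i => ?_
  have hnorm : ∀ j : DesignIdx d, ‖Δ • j.dir‖ ≤ Δ := fun j => by
    rw [norm_smul, Real.norm_of_nonneg hΔ.le]
    exact mul_le_of_le_one_right hΔ.le j.norm_dir_le
  -- In a central difference the constant and quadratic terms of the model cancel.
  have hdiff : Fb (.plus i) - Fb (.minus i) = 2 * Δ * g i := by
    rw [← hint, ← hint]
    simp only [quadModel, DesignIdx.dir, smul_neg, inner_neg_left, map_neg, inner_neg_right,
      real_inner_smul_left, EuclideanSpace.inner_single_left]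
    simp
    ring
  have hp := abs_le.1 (htaylor _ (hnorm (.plus i)))
  have hm := abs_le.1 (htaylor _ (hnorm (.minus i)))
  have hp' := abs_le.1 (hFb (.plus i))
  have hm' := abs_le.1 (hFb (.minus i))
  have hip : ∀ w : E d, inner ℝ (Δ • (DesignIdx.plus i).dir) w = Δ * w i := fun w => by
    rw [DesignIdx.dir, real_inner_smul_left, EuclideanSpace.inner_single_left]
    simp
  have him : ∀ w : E d, inner ℝ (Δ • (DesignIdx.minus i).dir) w = -(Δ * w i) := fun w => by
    rw [DesignIdx.dir, real_inner_smul_left, inner_neg_left, EuclideanSpace.inner_single_left]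
    simp
  rw [hip] at hp
  rw [him] at hm
  have hkey : |Δ * (g i - gradient f x i)| ≤ Δ * ((L + 1) * Δ) := by
    rw [abs_le]
    constructor <;> nlinarith
  rw [abs_mul, abs_of_pos hΔ] at hkey
  exact le_of_mul_le_mul_left hkey hΔ

/-- An interpolation model is accurate on the trust region. -/
lemma abs_quadModel_sub_le {κH : ℝ} (hΔ : 0 < Δ)
    (htaylor : ∀ s : E d, ‖s‖ ≤ Δ → |f (x + s) - f x - inner ℝ s (gradient f x)| ≤ L * Δ ^ 2)
    (hint : ∀ i : DesignIdx d, quadModel β₀ g h (Δ • i.dir) = Fb i)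
    (hFb : ∀ i : DesignIdx d, |Fb i - f (x + Δ • i.dir)| ≤ Δ ^ 2)
    (hH : ‖hess h‖ ≤ κH) {s : E d} (hs : ‖s‖ ≤ Δ) :
    |quadModel β₀ g h s - f (x + s)| ≤ (1 + d * (L + 1) + κH + L) * Δ ^ 2 := by
  have hβ : |β₀ - f x| ≤ Δ ^ 2 := by
    have := hFb .center
    rwa [← hint, DesignIdx.dir, smul_zero, quadModel_zero, add_zero] at this
  have hg : |inner ℝ s (g - gradient f x)| ≤ Δ * (d * ((L + 1) * Δ)) :=
    (abs_real_inner_le_norm _ _).trans (mul_le_mul hs (norm_modelGradient_sub_le hΔ htaylor hint hFb)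
      (norm_nonneg _) hΔ.le)
  have hquad : |inner ℝ s (hess h s)| ≤ Δ * (κH * Δ) :=
    (abs_real_inner_le_norm _ _).trans (mul_le_mul hs (((hess h).le_of_opNorm_le hH s).trans
      (mul_le_mul_of_nonneg_left hs ((norm_nonneg _).trans hH))) (norm_nonneg _) hΔ.le)
  have ht := htaylor s hs
  rw [inner_sub_right] at hg
  rw [quadModel]
  rw [abs_le] at *
  constructor <;> nlinarith

end Model

/-! ### Deterministic properties of a run -/

namespace Run

variable {d : ℕ} {Ω Ξ : Type*} {r : Run d Ω Ξ} {par : Params} {F : E d → Ξ → ℝ} {x₀ : E d} {ω : Ω}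

lemma lt_norm_gradient_of_lt_stopTime {f : E d → ℝ} {ε : ℝ} {k : ℕ}
    (h : (k : ℕ∞) < r.stopTime f ε ω) : ε < ‖gradient f (r.X k ω)‖ := by
  by_contra hcon
  have hle : r.stopTime f ε ω ≤ k := sInf_le ⟨k, not_lt.1 hcon, rfl⟩
  exact absurd hle (not_le.2 h)

lemma IsTrajectory.Δ_succ_of_successful (hr : r.IsTrajectory par F x₀ ω) {k : ℕ}
    (h : r.Successful par F k ω) : r.Δ (k + 1) ω = min (par.γ₁ * r.Δ k ω) par.Δmax := by
  by_cases hd : r.DirectTest par F k ω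
  · exact (hr.update_direct k hd).2
  · exact (hr.update_model k hd (h.resolve_left hd)).2

lemma IsTrajectory.Δ_succ_of_not_successful (hr : r.IsTrajectory par F x₀ ω) {k : ℕ}
    (h : ¬ r.Successful par F k ω) : r.Δ (k + 1) ω = par.γ₂ * r.Δ k ω :=
  (hr.update_fail k (fun hd => h (Or.inl hd)) fun hm => h (Or.inr hm)).2

/-- The radii decay at most geometrically. -/
lemma IsTrajectory.mul_pow_le_Δ (hr : r.IsTrajectory par F x₀ ω) (k : ℕ) :
    min par.Δ₀ par.Δmax * par.γ₂ ^ k ≤ r.Δ k ω := by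
  have hγ0 := par.γ₂_mem.1
  have hγ1 := par.γ₂_mem.2
  have hmin : 0 < min par.Δ₀ par.Δmax := lt_min par.Δ₀_pos par.Δmax_pos
  induction k with
  | zero => simp [hr.init_Δ]
  | succ k ih =>
    have hpow : 0 < min par.Δ₀ par.Δmax * par.γ₂ ^ k := by positivity
    have hle : min par.Δ₀ par.Δmax * par.γ₂ ^ (k + 1) ≤ min par.Δ₀ par.Δmax * par.γ₂ ^ k := by
      rw [pow_succ]
      nlinarith
    -- Even a successful iteration can reduce the radius, through the cap, as `Δ₀` may exceed
    -- `Δmax`; hence the minimum in the bound.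
    by_cases hs : r.Successful par F k ω
    · rw [hr.Δ_succ_of_successful hs]
      refine le_min ?_ ?_
      · have := par.one_lt_γ₁
        nlinarith
      · calc min par.Δ₀ par.Δmax * par.γ₂ ^ (k + 1) ≤ min par.Δ₀ par.Δmax * 1 := by
              gcongr
              exact pow_le_one₀ hγ0.le hγ1.le
          _ ≤ par.Δmax := by simp
    · rw [hr.Δ_succ_of_not_successful hs, pow_succ, ← mul_assoc, mul_comm]
      gcongr

lemma IsTrajectory.Δ_pos (hr : r.IsTrajectory par F x₀ ω) (k : ℕ) : 0 < r.Δ k ω :=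
  lt_of_lt_of_le (mul_pos (lt_min par.Δ₀_pos par.Δmax_pos) (pow_pos par.γ₂_mem.1 k))
    (hr.mul_pow_le_Δ k)

/-- An iteration with accurate estimates and a large model gradient is successful. -/
lemma IsTrajectory.successful_of_accurate (hr : r.IsTrajectory par F x₀ ω) {f : E d → ℝ} {k : ℕ}
    {L κH κfcd : ℝ} (hL : 0 ≤ L) (hκH : 0 < κH) (hκ : 0 < κfcd)
    (htaylor : ∀ s : E d, ‖s‖ ≤ r.Δ k ω →
      |f (r.X k ω + s) - f (r.X k ω) - inner ℝ s (gradient f (r.X k ω))| ≤ L * r.Δ k ω ^ 2)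
    (hacc : ∀ i, |r.Fbar par F k i ω - f (r.point k i ω)| ≤ r.Δ k ω ^ 2)
    (hH : ‖hess (r.h k ω)‖ ≤ κH) {Sc : E d}
    (hSc : IsCauchyStep (r.β₀ k ω) (r.G k ω) (r.h k ω) (r.Δ k ω) Sc)
    (hfcd : κfcd * (r.model k ω 0 - r.model k ω Sc) ≤ r.model k ω 0 - r.model k ω (r.S k ω))
    (hgrad : (d * (L + 1) + (1 / par.μ + κH +
      2 * (2 + d * (L + 1) + κH + L) / ((1 - par.η) * κfcd))) * r.Δ k ω
        ≤ ‖gradient f (r.X k ω)‖) :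
    r.Successful par F k ω := by
  set Δ := r.Δ k ω with hΔdef
  have hΔ : 0 < Δ := hr.Δ_pos k
  have hη := par.η_mem.2
  have hη' : 0 < 1 - par.η := by linarith
  have hμ := par.μ_pos
  -- The constant of `abs_quadModel_sub_le`, plus 1 for the estimate at the candidate.
  set Q := 2 + d * (L + 1) + κH + L with hQ
  have hQ0 : 0 < Q := by positivity
  have hG : ‖r.G k ω - gradient f (r.X k ω)‖ ≤ d * ((L + 1) * Δ) :=
    norm_modelGradient_sub_le hΔ htaylor (fun i => hr.interpolates k i) fun i => hacc (some i)
  -- The three summands serve the criticality test, the bound `‖G‖ / ‖H‖ ≥ Δ`, and the domination of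
  -- the error `Q Δ²`.
  have hGlow : (1 / par.μ + κH + 2 * Q / ((1 - par.η) * κfcd)) * Δ ≤ ‖r.G k ω‖ := by
    have := norm_sub_norm_le (gradient f (r.X k ω)) (r.G k ω)
    rw [norm_sub_rev] at this
    nlinarith
  have h1 : 0 < 1 / par.μ * Δ := by positivity
  have h2 : 0 < κH * Δ := by positivity
  have h3 : 0 < 2 * Q / ((1 - par.η) * κfcd) * Δ := by positivity
  have hGμ : 1 / par.μ * Δ ≤ ‖r.G k ω‖ := by linarith
  have hGH : κH * Δ ≤ ‖r.G k ω‖ := by linarith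
  have hGQ : 2 * Q / ((1 - par.η) * κfcd) * Δ ≤ ‖r.G k ω‖ := by linarith
  have hmin : (if ‖hess (r.h k ω)‖ = 0 then Δ else min (‖r.G k ω‖ / ‖hess (r.h k ω)‖) Δ) = Δ := by
    split_ifs with h0
    · rfl
    · refine min_eq_right ?_
      rw [le_div_iff₀ (lt_of_le_of_ne (norm_nonneg _) (Ne.symm h0))]
      nlinarith
  have hred : κfcd * (1 / 2 * ‖r.G k ω‖ * Δ) ≤ r.redModel k ω := by
    have hC := hSc.2
    rw [hmin] at hC
    exact (mul_le_mul_of_nonneg_left hC hκ.le).trans hfcd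
  -- Model and estimate agree exactly at the incumbent, so the two reductions differ only at the
  -- candidate.
  have hsub : r.redModel k ω - Q * Δ ^ 2 ≤ r.redSub par F k ω := by
    have hm := (abs_le.1 (abs_quadModel_sub_le hΔ htaylor (fun i => hr.interpolates k i)
      (fun i => hacc (some i)) hH (hr.step_le k))).1
    have hn := (abs_le.1 (hacc none)).2
    have hc : r.model k ω 0 = r.Fbar par F k (some .center) ω := by
      rw [← hr.interpolates k .center, DesignIdx.dir, smul_zero]
    simp only [redModel, redSub, point] at hn ⊢
    rw [hc]
    change _ ≤ r.model k ω (r.S k ω) - _ at hm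
    rw [hQ]
    linarith
  have hQle : Q * Δ ^ 2 ≤ (1 - par.η) * r.redModel k ω := by
    rw [div_mul_eq_mul_div, div_le_iff₀ (by positivity)] at hGQ
    have h4 := mul_le_mul_of_nonneg_left hred hη'.le
    nlinarith
  refine Or.inr ⟨by linarith, ?_⟩
  rw [one_div, inv_mul_le_iff₀ hμ] at hGμ
  exact hGμ

/-- If, from iteration `K` on, iterations with a large gradient and a short radius are successful,
the radii stay bounded below. -/
lemma IsTrajectory.exists_mul_le_Δ (hr : r.IsTrajectory par F x₀ ω) {f : E d → ℝ} {c_lb : ℝ}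
    (hc : 0 < c_lb) {K : ℕ}
    (hK : ∀ ε : ℝ, 0 < ε → ∀ k : ℕ, K ≤ k → (k : ℕ∞) < r.stopTime f ε ω →
      r.Δ k ω < c_lb * ε → r.Successful par F k ω) :
    ∃ c : ℝ, 0 < c ∧ ∀ ε : ℝ, 0 < ε → ∀ k : ℕ,
      (k : ℕ∞) < r.stopTime f ε ω → c * ε ≤ r.Δ k ω := by
  have hγ0 := par.γ₂_mem.1
  have hγ1 := par.γ₂_mem.2
  have hmin : 0 < min par.Δ₀ par.Δmax := lt_min par.Δ₀_pos par.Δmax_pos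
  set b := min par.Δ₀ par.Δmax * par.γ₂ ^ K with hb
  have hb0 : 0 < b := by positivity
  have hbmax : b ≤ par.Δmax :=
    (mul_le_of_le_one_right hmin.le (pow_le_one₀ hγ0.le hγ1.le)).trans (min_le_right _ _)
  -- Any `k < T_ε` forces `ε < ‖∇f(X_0)‖`, so `c ε ≤ b`; this covers the iterations up to `K` and
  -- the cap `Δmax`.
  set g := ‖gradient f (r.X 0 ω)‖ + 1 with hg
  have hg0 : 0 < g := by positivity
  refine ⟨min (par.γ₂ * c_lb) (b / g), by positivity, fun ε hε k hk => ?_⟩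
  set c := min (par.γ₂ * c_lb) (b / g) with hcdef
  have hcε : c * ε ≤ b := by
    have h0 : ε < ‖gradient f (r.X 0 ω)‖ :=
      lt_norm_gradient_of_lt_stopTime (lt_of_le_of_lt (by simp) hk)
    calc c * ε ≤ b / g * g := by
          gcongr
          · exact min_le_right _ _
          · linarith
      _ = b := div_mul_cancel₀ _ hg0.ne'
  have hcγ : c * ε ≤ par.γ₂ * (c_lb * ε) := by
    rw [← mul_assoc]
    gcongr
    exact min_le_left _ _
  rcases le_total k K with hkK | hkK
  · refine (hcε.trans ?_).trans (hr.mul_pow_le_Δ k)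
    exact mul_le_mul_of_nonneg_left (pow_le_pow_of_le_one hγ0.le hγ1.le hkK) hmin.le
  · induction k, hkK using Nat.le_induction with
    | base => exact hcε.trans (hr.mul_pow_le_Δ K)
    | succ k hkK ih =>
      have hk' : (k : ℕ∞) < r.stopTime f ε ω := lt_of_le_of_lt (by simp) hk
      have ih := ih hk'
      by_cases hs : r.Successful par F k ω
      · rw [hr.Δ_succ_of_successful hs]
        refine le_min (ih.trans ?_) (hcε.trans hbmax)
        exact le_mul_of_one_le_left (hr.Δ_pos k).le par.one_lt_γ₁.le
      · have hlong : c_lb * ε ≤ r.Δ k ω := not_lt.1 fun hlt => hs (hK ε hε k hkK hk' hlt)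
        rw [hr.Δ_succ_of_not_successful hs]
        exact hcγ.trans (mul_le_mul_of_nonneg_left hlong hγ0.le)

end Run

/-! ### Accuracy of the function estimates along a run -/

instance (d : ℕ) : Finite (DesignIdx d) :=
  Finite.of_surjective
    (fun i : Option (Fin d ⊕ Fin d) => match i with
      | none => DesignIdx.center
      | some (.inl i) => .plus i
      | some (.inr i) => .minus i)
    fun i => match i with
      | .center => ⟨none, rfl⟩
      | .plus i => ⟨some (.inl i), rfl⟩
      | .minus i => ⟨some (.inr i), rfl⟩

/-- Almost surely, all estimates are eventually as accurate as the squared radius. -/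
theorem ae_eventually_abs_Fbar_sub_le {d : ℕ} {Ω Ξ : Type*} [mΩ : MeasurableSpace Ω]
    [MeasurableSpace Ξ] {Pr : Measure Ω} [IsProbabilityMeasure Pr] {P : Measure Ξ}
    {𝓕 : Filtration ℕ mΩ} {F : E d → Ξ → ℝ} {par : Params} {x₀ : E d} {r : Run d Ω Ξ}
    (hrun : ∀ᵐ ω ∂Pr, r.IsTrajectory par F x₀ ω) (horacle : OracleAssumption Pr 𝓕 F P r)
    (hlam : LambdaAssumption par.lam) :
    ∀ᵐ ω ∂Pr, ∀ᶠ k in atTop, ∀ i,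
      |r.Fbar par F k i ω - objective F P (r.point k i ω)| ≤ r.Δ k ω ^ 2 := by
  obtain ⟨σ, b, -, hb, hmom⟩ := horacle.moments
  have hmeas : ∀ k i j, Measurable (r.err F P k i j) := fun k i j =>
    (horacle.measurable_err k i j).mono (𝓕.le (k + 1)) le_rfl
  have hlog := hlam.eventually_mul_log_le par.lam_pos
  have hmin : 0 < min par.Δ₀ par.Δmax := lt_min par.Δ₀_pos par.Δmax_pos
  have hlabel : ∀ i, ∀ᵐ ω ∂Pr, ∀ᶠ k in atTop,
      |r.Fbar par F k i ω - objective F P (r.point k i ω)| ≤ r.Δ k ω ^ 2 := by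
    intro i
    have hZ := hmeas 0 i 0
    have hid : ∀ k j, IdentDistrib (r.err F P k i j) (r.err F P 0 i 0) Pr Pr := fun k j =>
      horacle.identDistrib k i j
    have hind : ∀ k, iIndepFun (r.err F P k i) Pr := fun k => horacle.iIndep k i
    obtain ⟨s, hs, hexp⟩ := exists_integrable_exp_mul_abs hb hZ (hmom 0 i 0)
    have hsq : Integrable (fun ω => r.err F P 0 i 0 ω ^ 2) Pr := by
      simpa using integrable_pow_mul_exp_abs hZ hexp hs 2
    filter_upwards [hrun, ae_sampleSizeSet_nonempty hind hid hsq,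
      ae_eventually_abs_estimate_le (fun k j => hmeas k i j) hind hid hZ hs hexp
        (horacle.mean_zero 0 i 0) par.lam_pos hlog par.κ_pos one_pos hmin par.γ₂_mem.1
        par.γ₂_mem.2.le] with ω hr hne hω
    filter_upwards [hω] with k hk
    have hobs : (fun j => r.obs F k i j ω) =
        fun j => objective F P (r.point k i ω) + r.err F P k i j ω := by
      ext j
      rw [Run.err]
      ring
    rw [Run.Fbar, hobs, estimate_const_add _
      (hne k par.κ (par.lam k) (r.Δ k ω) par.κ_pos (par.lam_pos k) (hr.Δ_pos k)),
      add_sub_cancel_left]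
    -- The bound is uniform over radii above the geometric floor, so the random radius is
    -- substituted pathwise.
    simpa using hk (r.Δ k ω) (hr.mul_pow_le_Δ k)
  filter_upwards [ae_all_iff.2 hlabel] with ω hω
  exact eventually_all.2 hω

end AstroDF

end

theorem mainTheorem5 {d : ℕ} {Ω Ξ : Type*} [mΩ : MeasurableSpace Ω] [MeasurableSpace Ξ]
    (Pr : Measure Ω) [IsProbabilityMeasure Pr] (P : Measure Ξ) [IsProbabilityMeasure P]
    (𝓕 : Filtration ℕ mΩ) (F : AstroDF.E d → Ξ → ℝ) (U : Set (AstroDF.E d))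
    (par : AstroDF.Params) (x₀ : AstroDF.E d) (r : AstroDF.Run d Ω Ξ)
    (hrun : ∀ᵐ ω ∂Pr, r.IsTrajectory par F x₀ ω)
    (hf : AstroDF.SmoothOn (AstroDF.objective F P) U)
    (hU : ∀ᵐ ω ∂Pr, ∀ k, Metric.closedBall (r.X k ω) (r.Δ k ω) ⊆ U)
    (horacle : AstroDF.OracleAssumption Pr 𝓕 F P r)
    (hmodel : AstroDF.ModelAssumption Pr r)
    (hlam : AstroDF.LambdaAssumption par.lam) :
    (∃ c_lb : ℝ, 0 < c_lb ∧ ∀ᵐ ω ∂Pr, ∃ K : ℕ, ∀ ε : ℝ, 0 < ε → ∀ k : ℕ, K ≤ k →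
      (k : ℕ∞) < r.stopTime (AstroDF.objective F P) ε ω → r.Δ k ω < c_lb * ε →
        r.Successful par F k ω) ∧
    (∀ᵐ ω ∂Pr, ∃ c : ℝ, 0 < c ∧ ∀ ε : ℝ, 0 < ε → ∀ k : ℕ,
      (k : ℕ∞) < r.stopTime (AstroDF.objective F P) ε ω → c * ε ≤ r.Δ k ω) := by
  obtain ⟨L, hL⟩ := hf.lipschitz_gradient
  obtain ⟨κfcd, ⟨hκfcd, -⟩, hcauchy⟩ := hmodel.cauchy
  obtain ⟨κH, hκH, hhess⟩ := hmodel.hess_bdd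
  -- The deterministic ratio `‖∇f‖ / Δ` from which accurate iterations succeed; before `T_ε`, `Δ < ε
  -- / A` gives `A Δ < ε < ‖∇f‖`.
  set A : ℝ := d * ((L : ℝ) + 1) + (1 / par.μ + κH +
    2 * (2 + d * ((L : ℝ) + 1) + κH + L) / ((1 - par.η) * κfcd)) with hA
  have hμ := par.μ_pos
  have hη : 0 < 1 - par.η := by linarith [par.η_mem.2]
  have hA0 : 0 < A := by positivity
  have hsucc : ∀ᵐ ω ∂Pr, ∃ K : ℕ, ∀ ε : ℝ, 0 < ε → ∀ k : ℕ, K ≤ k →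
      (k : ℕ∞) < r.stopTime (AstroDF.objective F P) ε ω → r.Δ k ω < A⁻¹ * ε →
        r.Successful par F k ω := by
    filter_upwards [hrun, hU, hcauchy, hhess,
      AstroDF.ae_eventually_abs_Fbar_sub_le hrun horacle hlam] with ω hr hball hC hH hacc
    obtain ⟨K, hK⟩ := eventually_atTop.1 hacc
    refine ⟨K, fun ε hε k hk hlt hΔ => ?_⟩
    obtain ⟨Sc, hSc, hfcd⟩ := hC k
    refine hr.successful_of_accurate L.coe_nonneg hκH hκfcd (fun s hs =>
      AstroDF.abs_sub_inner_gradient_le hf.isOpen (hf.contDiffOn.differentiableOn (by norm_num)) hL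
        (hball k) hs) (hK k hk) (hH k) hSc hfcd ?_
    have hgrad := AstroDF.Run.lt_norm_gradient_of_lt_stopTime hlt
    rw [inv_mul_eq_div, lt_div_iff₀ hA0] at hΔ
    rw [← hA]
    linarith
  refine ⟨⟨A⁻¹, inv_pos.2 hA0, hsucc⟩, ?_⟩
  filter_upwards [hrun, hsucc] with ω hr ⟨K, hK⟩
  exact hr.exists_mul_le_Δ (inv_pos.2 hA0) hK
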